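/- Let $n\ge 2$, let $\Omega\subset\mathbb R^n$ be a bounded domain (non-empty, open, connected), let $\epsilon>0$, and let $\alpha\ge 0$, $\beta>0$ with $\alpha+\beta=1$. Put $$\Gamma_\epsilon=\{x\in\mathbb R^n:\operatorname{dist}(x,\partial\Omega)\le\epsilon\},\quad O_\epsilon=\Gamma_\epsilon\setminus\Omega,\quad I_\epsilon=\Gamma_\epsilon\cap\Omega,\quad \Omega_\epsilon=\Omega\cup O_\epsilon,$$ let $F:\Gamma_\epsilon\to\mathbb R$ be Lipschitz continuous, and let $\delta:\Omega_\epsilon\to[0,1]$ be $0$ on $\Omega\setminus I_\epsilon$, $1-\epsilon^{-1}\operatorname{dist}(x,\partial\Omega)$ on $I_\epsilon$, and $1$ on $O_\epsilon$. For $|v|=\epsilon$ let $\mu_v$ be the uniform $(n-1)$-dimensional probability measure on the closed disk $\{z:\langle v,z\rangle=0,\ |z|\le\epsilon\}$. For $u:\Omega_\epsilon\to\mathbb R$ put $$Iu(x)=\frac{1-\delta(x)}2\Big[\sup_{|v|=\epsilon}\Big(\alpha u(x+v)+\beta\int u(x+z)\,d\mu_v(z)\Big)+\inf_{|v|=\epsilon}\Big(\alpha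 u(x+v)+\beta\int u(x+z)\,d\mu_v(z)\Big)\Big]+\delta(x)F(x),$$ and let $\overline u(x)=\lim_{k\to\infty}I^k u_0(x)$, where $u_0\equiv\sup_{\Gamma_\epsilon}F$; this is the upper semicontinuous solution of the dynamic programming principle $u=Iu$. Consider the following game started at $x_0=x\in\Omega_\epsilon$. When the token is at $x_k$, the game ends with probability $\delta(x_k)$; then $x_\tau:=x_k$, and Player II pays $F(x_\tau)$ to Player I. Otherwise a fair coin selects one of the players, whose strategy prescribes a vector $v$ with $|v|=\epsilon$ as a function of $(x_0,\dots,x_k)$, and $x_{k+1}=x_k+v$ with probability $\alpha$, while with probability $\beta$ one has $x_{k+1}=x_k+z$ with $z$ distributed according to $\mu_v$. The strategies $S_{\mathrm I}$ and $S_{\mathrm{II}}$ of the two players are Borel measurable maps of the history. The value for Player I is $$u_{\mathrm I}(x)=\sup_{S_{\mathrm I}}\inf_{S_{\mathrm{II}}}\mathbb E^{x}_{S_{\mathrm I},S_{\mathrm{II}}}[F(x_\tau)].$$ Then, for every $x\in\Omega_\epsilon$, the limit defining $\overline u(x)$ exists and $\overline u(x)\le u_{\mathrm I}(x)$. -/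

import Mathlib

open Set Filter Topology MeasureTheory ProbabilityTheory
open scoped ENNReal RealInnerProductSpace

noncomputable section

namespace TugOfWar

/-! ### The orthogonal noise -/

/-- The closed disk of radius `ε` centred at the origin of the hyperplane orthogonal to `v`. -/
def orthDisk {n : ℕ} (ε : ℝ) (v : EuclideanSpace ℝ (Fin n)) : Set (EuclideanSpace ℝ (Fin n)) :=
  {z | ⟪v, z⟫ = 0 ∧ ‖z‖ ≤ ε}

/-- The measure `μ_v`: the uniform `(n - 1)`-dimensional probability measure on the closed disk of
radius `ε` orthogonal to `v`, that is, `(n - 1)`-dimensional volume (Euclidean Hausdorff measure)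
restricted to the disk and normalized. -/
def noise {n : ℕ} (ε : ℝ) (v : EuclideanSpace ℝ (Fin n)) : Measure (EuclideanSpace ℝ (Fin n)) :=
  ProbabilityTheory.cond (Measure.euclideanHausdorffMeasure (n - 1)) (orthDisk ε v)

theorem measurableSet_orthDisk {n : ℕ} (ε : ℝ) (v : EuclideanSpace ℝ (Fin n)) :
    MeasurableSet (orthDisk ε v) := by
  have h1 : IsClosed {z : EuclideanSpace ℝ (Fin n) | ⟪v, z⟫ = 0} :=
    isClosed_eq (by fun_prop) (by fun_prop)
  have h2 : IsClosed {z : EuclideanSpace ℝ (Fin n) | ‖z‖ ≤ ε} :=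
    isClosed_le (by fun_prop) (by fun_prop)
  exact (h1.inter h2).measurableSet

theorem measure_orthDisk {n : ℕ} {ε : ℝ} (hε : 0 < ε) {v : EuclideanSpace ℝ (Fin n)} (hv : v ≠ 0) :
    (Measure.euclideanHausdorffMeasure (n - 1) : Measure (EuclideanSpace ℝ (Fin n)))
        (orthDisk ε v) ≠ 0 ∧
    (Measure.euclideanHausdorffMeasure (n - 1) : Measure (EuclideanSpace ℝ (Fin n)))
        (orthDisk ε v) ≠ ⊤ := by
  have hrank : Module.finrank ℝ (Submodule.span ℝ {v})ᗮ = n - 1 := by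
    have h := Submodule.finrank_add_finrank_orthogonal (Submodule.span ℝ {v})
    rw [finrank_span_singleton hv, finrank_euclideanSpace_fin] at h
    omega
  have himg : orthDisk ε v =
      (Submodule.span ℝ {v})ᗮ.subtypeₗᵢ '' Metric.closedBall 0 ε := by
    ext z
    simp only [orthDisk, mem_ofPred_eq, mem_image, Metric.mem_closedBall, dist_zero_right]
    constructor
    · rintro ⟨h1, h2⟩
      exact ⟨⟨z, Submodule.mem_orthogonal_singleton_iff_inner_right.2 h1⟩, h2, rfl⟩
    · rintro ⟨w, hw, rfl⟩
      exact ⟨Submodule.mem_orthogonal_singleton_iff_inner_right.1 w.2, hw⟩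
  rw [himg, Isometry.euclideanHausdorffMeasure_image (LinearIsometry.isometry _), ← hrank]
  exact ⟨(Metric.measure_closedBall_pos _ _ hε).ne', (isCompact_closedBall _ _).measure_lt_top.ne⟩

theorem isProbabilityMeasure_noise {n : ℕ} {ε : ℝ} (hε : 0 < ε) {v : EuclideanSpace ℝ (Fin n)}
    (hv : v ≠ 0) : IsProbabilityMeasure (noise ε v) :=
  cond_isProbabilityMeasure_of_finite (measure_orthDisk hε hv).1 (measure_orthDisk hε hv).2

/-- A reflection carries the noise orthogonal to one vector to the noise orthogonal to another. -/
theorem noise_eq_map {n : ℕ} {ε : ℝ} {v w : EuclideanSpace ℝ (Fin n)} (h : ‖v‖ = ‖w‖) :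
    noise ε w = (noise ε v).map (Submodule.reflection (Submodule.span ℝ {v - w})ᗮ) := by
  have hRv : Submodule.reflection (Submodule.span ℝ {v - w})ᗮ v = w :=
    Submodule.reflection_sub h
  generalize Submodule.reflection (Submodule.span ℝ {v - w})ᗮ = R at hRv
  have hpre : R ⁻¹' orthDisk ε w = orthDisk ε v := by
    ext z
    simp only [orthDisk, mem_preimage, mem_ofPred_eq, ← hRv, LinearIsometryEquiv.inner_map_map,
      LinearIsometryEquiv.norm_map]
  have hmp := R.toIsometryEquiv.measurePreserving_euclideanHausdorffMeasure (n - 1)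
  have hmeas : Measurable R := R.continuous.measurable
  have hμ : ∀ s : Set (EuclideanSpace ℝ (Fin n)), MeasurableSet s →
      (Measure.euclideanHausdorffMeasure (n - 1) : Measure (EuclideanSpace ℝ (Fin n))) (R ⁻¹' s) =
        Measure.euclideanHausdorffMeasure (n - 1) s :=
    fun s hs => hmp.measure_preimage hs.nullMeasurableSet
  ext s hs
  rw [Measure.map_apply hmeas hs, noise, noise, cond_apply (measurableSet_orthDisk _ _),
    cond_apply (measurableSet_orthDisk _ _), ← hpre, ← preimage_inter,
    hμ _ (measurableSet_orthDisk _ _), hμ _ ((measurableSet_orthDisk _ _).inter hs)]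

theorem measurable_noise {n : ℕ} {ε : ℝ} (hε : 0 < ε) :
    Measurable fun v : Metric.sphere (0 : EuclideanSpace ℝ (Fin n)) ε =>
      noise ε (v : EuclideanSpace ℝ (Fin n)) := by
  rcases isEmpty_or_nonempty (Metric.sphere (0 : EuclideanSpace ℝ (Fin n)) ε) with h | ⟨⟨v₀⟩⟩
  · exact measurable_of_empty _
  have hne : (v₀ : EuclideanSpace ℝ (Fin n)) ≠ 0 := ne_zero_of_mem_sphere hε.ne' v₀
  have := isProbabilityMeasure_noise hε hne
  refine Measure.measurable_of_measurable_coe _ fun s hs => ?_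
  have hjoint : Measurable
      fun p : Metric.sphere (0 : EuclideanSpace ℝ (Fin n)) ε × EuclideanSpace ℝ (Fin n) =>
        Submodule.reflection
          (Submodule.span ℝ {(v₀ : EuclideanSpace ℝ (Fin n)) - (p.1 : _)})ᗮ p.2 := by
    simp only [Submodule.reflection_orthogonal_apply, Submodule.reflection_singleton_apply]
    have : Measurable
      fun p : Metric.sphere (0 : EuclideanSpace ℝ (Fin n)) ε × EuclideanSpace ℝ (Fin n) =>
        (p.1 : EuclideanSpace ℝ (Fin n)) := measurable_subtype_coe.comp measurable_fst
    simp only [two_smul, RCLike.ofReal_real_eq_id, id_eq]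
    have hsub : Measurable
      fun p : Metric.sphere (0 : EuclideanSpace ℝ (Fin n)) ε × EuclideanSpace ℝ (Fin n) =>
        (v₀ : EuclideanSpace ℝ (Fin n)) - (p.1 : EuclideanSpace ℝ (Fin n)) := this.const_sub _
    have hcoef := ((hsub.inner measurable_snd).div (hsub.norm.pow_const 2)).smul hsub
    exact ((hcoef.add hcoef).sub measurable_snd).neg
  have heq : ∀ v : Metric.sphere (0 : EuclideanSpace ℝ (Fin n)) ε,
      noise ε (v : EuclideanSpace ℝ (Fin n)) s =
        noise ε (v₀ : EuclideanSpace ℝ (Fin n)) (Prod.mk v ⁻¹'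
          ((fun p : Metric.sphere (0 : EuclideanSpace ℝ (Fin n)) ε × EuclideanSpace ℝ (Fin n) =>
            Submodule.reflection
              (Submodule.span ℝ {(v₀ : EuclideanSpace ℝ (Fin n)) - (p.1 : _)})ᗮ p.2) ⁻¹' s)) := by
    intro v
    have hn : ‖(v₀ : EuclideanSpace ℝ (Fin n))‖ = ‖(v : EuclideanSpace ℝ (Fin n))‖ := by
      rw [norm_eq_of_mem_sphere, norm_eq_of_mem_sphere]
    rw [noise_eq_map hn, Measure.map_apply (LinearIsometryEquiv.continuous _).measurable hs]
    rfl
  simp only [heq]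
  exact measurable_measure_prodMk_left (hjoint hs)

/-! ### The data of the problem -/

/-- The data of the problem in `ℝⁿ` with the standing assumptions: a bounded domain `Ω`, a step size
`ε > 0`, weights `α ≥ 0` and `β > 0` with `α + β = 1`, and boundary data `F` that is Lipschitz
continuous on the strip `Γ_ε = {x | dist(x, ∂Ω) ≤ ε}`. The values of `F` off this strip are never
used below. -/
structure Data (n : ℕ) where
  /-- The domain `Ω`. -/
  Ω : Set (EuclideanSpace ℝ (Fin n))
  /-- The step size. -/
  ε : ℝ
  /-- The weight of the intended move. -/
  α : ℝ
  /-- The weight of the orthogonal noise. -/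
  β : ℝ
  /-- The boundary data. -/
  F : EuclideanSpace ℝ (Fin n) → ℝ
  isOpen : IsOpen Ω
  isConnected : IsConnected Ω
  isBounded : Bornology.IsBounded Ω
  ε_pos : 0 < ε
  α_nonneg : 0 ≤ α
  β_pos : 0 < β
  α_add_β : α + β = 1
  lipschitz : ∃ K, LipschitzOnWith K F {x | Metric.infDist x (frontier Ω) ≤ ε}

namespace Data

variable {n : ℕ} (G : Data n)

/-- The boundary strip `Γ_ε`, on which the boundary data lives. -/
def strip : Set (EuclideanSpace ℝ (Fin n)) := {x | Metric.infDist x (frontier G.Ω) ≤ G.ε}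

/-- The outside boundary strip `O_ε`. -/
def outer : Set (EuclideanSpace ℝ (Fin n)) :=
  {x | x ∉ G.Ω ∧ Metric.infDist x (frontier G.Ω) ≤ G.ε}

/-- The thickened domain `Ω_ε`. -/
def thick : Set (EuclideanSpace ℝ (Fin n)) := G.Ω ∪ G.outer

open Classical in
/-- The cutoff function `δ`: it is `0` at the points of `Ω` at distance more than `ε` from `∂Ω`,
`1 - dist(x, ∂Ω) / ε` at the other points of `Ω`, and `1` on the outside strip. (Points outside
the thickened domain play no role.) -/
def cutoff (x : EuclideanSpace ℝ (Fin n)) : ℝ :=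
  if x ∈ G.Ω then
    if Metric.infDist x (frontier G.Ω) ≤ G.ε then
      1 - G.ε⁻¹ * Metric.infDist x (frontier G.Ω)
    else 0
  else 1

/-! ### The dynamic programming principle -/

/-- The expectation of `u` after a move from `x` with chosen vector `v`:
`α u(x + v) + β ∫ u(x + z) dμ_v(z)`. -/
def average (u : EuclideanSpace ℝ (Fin n) → ℝ) (x v : EuclideanSpace ℝ (Fin n)) : ℝ :=
  G.α * u (x + v) + G.β * ∫ z, u (x + z) ∂(noise G.ε v)

/-- The operator `I`; a solution of the dynamic programming principle is a function `u` with
`I u = u` on the thickened domain. -/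
def op (u : EuclideanSpace ℝ (Fin n) → ℝ) (x : EuclideanSpace ℝ (Fin n)) : ℝ :=
  (1 - G.cutoff x) / 2 *
      ((⨆ v : Metric.sphere (0 : EuclideanSpace ℝ (Fin n)) G.ε, G.average u x v) +
        ⨅ v : Metric.sphere (0 : EuclideanSpace ℝ (Fin n)) G.ε, G.average u x v) +
    G.cutoff x * G.F x

/-- The iterates `I^k u₀` started from the constant function `u₀ = sup F`. -/
def upperIterate (k : ℕ) : EuclideanSpace ℝ (Fin n) → ℝ :=
  G.op^[k] fun _ => sSup (G.F '' G.strip)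

/-- The upper semicontinuous solution `ū = lim_k I^k (sup F)` of the dynamic programming
principle. -/
def upperSolution (x : EuclideanSpace ℝ (Fin n)) : ℝ :=
  limUnder atTop fun k => G.upperIterate k x

/-! ### The game -/

/-- A Borel measurable strategy: it maps every history `(x_0, …, x_k)` of token positions to the
next intended move, a vector of length `ε`. (During the game the token stays in the thickened
domain, which is closed, so it makes no difference that the map is also defined on other
histories.) -/
structure Strategy (G : Data n) where
  /-- The intended move after a given history. -/
  move : ∀ k : ℕ, (Finset.Iic k → EuclideanSpace ℝ (Fin n)) →
    Metric.sphere (0 : EuclideanSpace ℝ (Fin n)) G.ε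
  measurable_move : ∀ k, Measurable (move k)

/-- A state of the game: the position of the token, and whether the game has ended. -/
abbrev State (_G : Data n) : Type := EuclideanSpace ℝ (Fin n) × Bool

/-- The law of the new position of a token at `x` that is moved with chosen vector `v`: it is
`x + v` with probability `α`, and `x + z` with `z` distributed according to `μ_v` with
probability `β`. -/
def moveLaw (x v : EuclideanSpace ℝ (Fin n)) : Measure (EuclideanSpace ℝ (Fin n)) :=
  ENNReal.ofReal G.α • Measure.dirac (x + v) +
    ENNReal.ofReal G.β • (noise G.ε v).map (fun z => x + z)

variable {G} in
/-- The positions in a history of states. -/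
def positions {k : ℕ} (h : Finset.Iic k → State G) : Finset.Iic k → EuclideanSpace ℝ (Fin n) :=
  fun i => (h i).1

variable {G} in
/-- The current state of a history of states. -/
def current {k : ℕ} (h : Finset.Iic k → State G) : State G := h ⟨k, Finset.mem_Iic.2 le_rfl⟩

/-- The conditional law of the next state, given the history of states: if the game has ended,
nothing changes; otherwise the game ends at the current position `x` with probability `δ(x)`,
and with the remaining probability a fair coin decides which player moves the token. -/
def stepLaw (S T : Strategy G) (k : ℕ) (h : Finset.Iic k → State G) : Measure (State G) :=
  if (current h).2 = true then Measure.dirac (current h)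
  else
    ENNReal.ofReal (G.cutoff (current h).1) • Measure.dirac ((current h).1, true) +
      ENNReal.ofReal (1 - G.cutoff (current h).1) •
        ((2⁻¹ : ℝ≥0∞) • (G.moveLaw (current h).1 (S.move k (positions h))).map (fun y => (y, false)) +
          (2⁻¹ : ℝ≥0∞) •
            (G.moveLaw (current h).1 (T.move k (positions h))).map (fun y => (y, false)))

theorem cutoff_mem (x : EuclideanSpace ℝ (Fin n)) : 0 ≤ G.cutoff x ∧ G.cutoff x ≤ 1 := by
  have h0 : 0 ≤ G.ε⁻¹ * Metric.infDist x (frontier G.Ω) :=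
    mul_nonneg (inv_nonneg.2 G.ε_pos.le) Metric.infDist_nonneg
  unfold cutoff
  split_ifs with h1 h2
  · refine ⟨?_, by linarith⟩
    have := mul_le_mul_of_nonneg_left h2 (inv_nonneg.2 G.ε_pos.le)
    rw [inv_mul_cancel₀ G.ε_pos.ne'] at this
    linarith
  · simp
  · simp

theorem measurable_cutoff : Measurable G.cutoff := by
  unfold cutoff
  refine Measurable.ite G.isOpen.measurableSet (Measurable.ite ?_ ?_ ?_) measurable_const
  · exact measurableSet_le (Metric.continuous_infDist_pt _).measurable measurable_const
  · exact measurable_const.sub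
      (measurable_const.mul (Metric.continuous_infDist_pt _).measurable)
  · exact measurable_const

theorem isProbabilityMeasure_moveLaw (x : EuclideanSpace ℝ (Fin n))
    (v : Metric.sphere (0 : EuclideanSpace ℝ (Fin n)) G.ε) :
    IsProbabilityMeasure (G.moveLaw x v) := by
  have := isProbabilityMeasure_noise G.ε_pos (ne_zero_of_mem_sphere G.ε_pos.ne' v)
  have : IsProbabilityMeasure ((noise G.ε (v : EuclideanSpace ℝ (Fin n))).map fun z => x + z) :=
    Measure.isProbabilityMeasure_map (by fun_prop)
  constructor
  simp only [moveLaw, Measure.add_apply, Measure.smul_apply, measure_univ, smul_eq_mul, mul_one]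
  rw [← ENNReal.ofReal_add G.α_nonneg G.β_pos.le, G.α_add_β, ENNReal.ofReal_one]

theorem isProbabilityMeasure_stepLaw (S T : Strategy G) (k : ℕ) (h : Finset.Iic k → State G) :
    IsProbabilityMeasure (G.stepLaw S T k h) := by
  unfold stepLaw
  split_ifs
  · infer_instance
  · have h1 := G.isProbabilityMeasure_moveLaw (current h).1 (S.move k (positions h))
    have h2 := G.isProbabilityMeasure_moveLaw (current h).1 (T.move k (positions h))
    have hm : Measurable fun y : EuclideanSpace ℝ (Fin n) => (y, false) := by fun_prop
    have h3 := Measure.isProbabilityMeasure_map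
      (μ := G.moveLaw (current h).1 (S.move k (positions h))) hm.aemeasurable
    have h4 := Measure.isProbabilityMeasure_map
      (μ := G.moveLaw (current h).1 (T.move k (positions h))) hm.aemeasurable
    constructor
    simp only [Measure.add_apply, Measure.smul_apply, measure_univ, smul_eq_mul, mul_one]
    have hc := G.cutoff_mem (current h).1
    rw [ENNReal.inv_two_add_inv_two, mul_one, ← ENNReal.ofReal_add hc.1 (by linarith)]
    simp

theorem measurable_moveLaw :
    Measurable fun p : EuclideanSpace ℝ (Fin n) ×
      Metric.sphere (0 : EuclideanSpace ℝ (Fin n)) G.ε => G.moveLaw p.1 p.2 := by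
  refine Measure.measurable_of_measurable_coe _ fun s hs => ?_
  let κ : Kernel (EuclideanSpace ℝ (Fin n) × Metric.sphere (0 : EuclideanSpace ℝ (Fin n)) G.ε)
      (EuclideanSpace ℝ (Fin n)) :=
    ⟨fun p => noise G.ε (p.2 : EuclideanSpace ℝ (Fin n)),
      (measurable_noise G.ε_pos).comp measurable_snd⟩
  have hκ : IsMarkovKernel κ :=
    ⟨fun p => isProbabilityMeasure_noise G.ε_pos (ne_zero_of_mem_sphere G.ε_pos.ne' p.2)⟩
  have hadd : ∀ x : EuclideanSpace ℝ (Fin n), Measurable fun z => x + z := fun x => by fun_prop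
  have h1 : Measurable fun p : EuclideanSpace ℝ (Fin n) ×
      Metric.sphere (0 : EuclideanSpace ℝ (Fin n)) G.ε =>
        p.1 + (p.2 : EuclideanSpace ℝ (Fin n)) :=
    measurable_fst.add (measurable_subtype_coe.comp measurable_snd)
  have h2 : MeasurableSet {q : (EuclideanSpace ℝ (Fin n) ×
      Metric.sphere (0 : EuclideanSpace ℝ (Fin n)) G.ε) × EuclideanSpace ℝ (Fin n) |
        q.1.1 + q.2 ∈ s} :=
    ((measurable_fst.comp measurable_fst).add measurable_snd) hs
  have h3 := Kernel.measurable_kernel_prodMk_left (κ := κ) h2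
  simp only [moveLaw, Measure.add_apply, Measure.smul_apply, smul_eq_mul,
    Measure.map_apply (hadd _) hs]
  refine Measurable.add (measurable_const.mul ?_) (measurable_const.mul h3)
  exact (Measure.measurable_coe hs).comp (Measure.measurable_dirac.comp h1)

theorem measurable_stepLaw (S T : Strategy G) (k : ℕ) : Measurable (G.stepLaw S T k) := by
  have hcur : Measurable (current (G := G) (k := k)) := measurable_pi_apply _
  have hpos : Measurable (positions (G := G) (k := k)) :=
    measurable_pi_lambda _ fun i => measurable_fst.comp (measurable_pi_apply i)
  have hx : Measurable fun h : Finset.Iic k → State G => (current h).1 := measurable_fst.comp hcur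
  have hδ : Measurable fun h : Finset.Iic k → State G => G.cutoff (current h).1 :=
    G.measurable_cutoff.comp hx
  have hm : Measurable fun y : EuclideanSpace ℝ (Fin n) => (y, false) := by fun_prop
  have hend : MeasurableSet {h : Finset.Iic k → State G | (current h).2 = true} :=
    (measurable_snd.comp hcur) (measurableSet_singleton true)
  have hmove : ∀ U : Strategy G, Measurable fun h : Finset.Iic k → State G =>
      (G.moveLaw (current h).1 (U.move k (positions h))).map (fun y => (y, false)) := by
    intro U
    have h1 : Measurable fun h : Finset.Iic k → State G =>
        ((current h).1, U.move k (positions h)) := hx.prodMk ((U.measurable_move k).comp hpos)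
    have h2 := G.measurable_moveLaw.comp h1
    exact (Measure.measurable_map _ hm).comp h2
  have hfin : Measurable fun h : Finset.Iic k → State G =>
      Measure.dirac ((current h).1, true) :=
    Measure.measurable_dirac.comp (hx.prodMk measurable_const)
  have hS := hmove S
  have hT := hmove T
  have hgo : Measurable fun h : Finset.Iic k → State G =>
      ENNReal.ofReal (G.cutoff (current h).1) • Measure.dirac ((current h).1, true) +
      ENNReal.ofReal (1 - G.cutoff (current h).1) •
        ((2⁻¹ : ℝ≥0∞) • (G.moveLaw (current h).1 (S.move k (positions h))).map (fun y => (y, false)) +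
          (2⁻¹ : ℝ≥0∞) •
            (G.moveLaw (current h).1 (T.move k (positions h))).map (fun y => (y, false))) := by
    refine Measure.measurable_of_measurable_coe _ fun s hs => ?_
    have h1 := (Measure.measurable_coe hs).comp hfin
    have h2 := (Measure.measurable_coe hs).comp hS
    have h3 := (Measure.measurable_coe hs).comp hT
    simp only [Measure.add_apply, Measure.smul_apply, smul_eq_mul]
    exact (hδ.ennreal_ofReal.mul h1).add ((measurable_const.sub hδ).ennreal_ofReal.mul
      ((measurable_const.mul h2).add (measurable_const.mul h3)))
  exact Measurable.ite hend (Measure.measurable_dirac.comp hcur) hgo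

/-- The transition kernel of the game in which Player I uses `S` and Player II uses `T`. -/
def stepKernel (S T : Strategy G) (k : ℕ) : Kernel (Finset.Iic k → State G) (State G) :=
  ⟨G.stepLaw S T k, G.measurable_stepLaw S T k⟩

instance (S T : Strategy G) (k : ℕ) : IsMarkovKernel (G.stepKernel S T k) :=
  ⟨G.isProbabilityMeasure_stepLaw S T k⟩

/-- The law of the trajectory of the game started at `x₀`, a probability measure on the space of
infinite sequences of states. -/
def law (S T : Strategy G) (x₀ : EuclideanSpace ℝ (Fin n)) : Measure (ℕ → State G) :=
  Kernel.traj (X := fun _ => State G) (G.stepKernel S T) 0 fun _ => (x₀, false)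

open Classical in
/-- The amount `F(x_τ)` that Player II pays to Player I, where `x_τ` is the position at which the
game ends. (On trajectories that never end, which have probability zero, the value is `0`.) -/
def payoff (ω : ℕ → State G) : ℝ :=
  if h : ∃ k, (ω k).2 = true then G.F (ω (Nat.find h)).1 else 0

/-- The value of the game for Player I: `u_I(x) = sup_S inf_T E[F(x_τ)]`. -/
def valueI (x : EuclideanSpace ℝ (Fin n)) : ℝ :=
  ⨆ S : Strategy G, ⨅ T : Strategy G, ∫ ω, G.payoff ω ∂(G.law S T x)

end Data

end TugOfWar

end

namespace TugOfWar

/-! ### Properties of the noise -/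

/-! Let M = sup F and V_k = I^k M. Since F ≤ M gives I M ≤ M, monotonicity of I makes V_k decreasing
in k; boundedness yields the limit ū, and ū ≤ V_N for every N. V_N(x) is the value of the game cut
off after N steps, with M paid if it has not ended. The proof compares the true game with this
finite one and never needs a selection for ū: each V_k is continuous, because δ is, because μ_v
depends continuously on v, and because F can be replaced by a continuous extension C without
changing V_k on Ω_ε (`upperIterate_eq_iterateWith`). Hence near-maximizing directions can be chosen
measurably.

Fix N and η > 0. At time j Player I maximizes the average of V_{N-1-j} up to η. Whatever Player II
does, a step lowers the expected continuation value by at most η, so the payoff of the finite game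
has mean at least V_N(x) - Nη (`exists_strategy_sub_le_integral_stateFun`). It differs from F(x_τ)
only if the game outlasts N steps, and then by at most 2K, where K bounds |F| on the strip.

That event has probability at most B q^N with q < 1, for all strategies
(`integral_stateFun_le_pow_mul`). The noise is the reason: it is centred and, as n ≥ 2, has positive
second moment, so for suitable l it makes exp(l|x|²) grow in mean by a fixed factor above 1 at each
move, even if the intended move contributes nothing. On a bounded set this cannot last
(`exists_contracting_function`). So ū(x) - Nη - 2K B q^N ≤ u_I(x); let η → 0, then N → ∞. -/

theorem ae_mem_orthDisk {n : ℕ} (ε : ℝ) (v : EuclideanSpace ℝ (Fin n)) :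
    ∀ᵐ z ∂(noise ε v), z ∈ orthDisk ε v :=
  ae_cond_mem (measurableSet_orthDisk ε v)

theorem noise_map_neg {n : ℕ} (ε : ℝ) (v : EuclideanSpace ℝ (Fin n)) :
    (noise ε v).map Neg.neg = noise ε v := by
  have hpre : Neg.neg ⁻¹' orthDisk ε v = orthDisk ε v := by
    ext z
    simp [orthDisk]
  have hmp := (LinearIsometryEquiv.neg ℝ (E := EuclideanSpace ℝ (Fin n))).toIsometryEquiv
    |>.measurePreserving_euclideanHausdorffMeasure (n - 1)
  have hμ : ∀ s : Set (EuclideanSpace ℝ (Fin n)), MeasurableSet s →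
      (Measure.euclideanHausdorffMeasure (n - 1) : Measure (EuclideanSpace ℝ (Fin n)))
        (Neg.neg ⁻¹' s) = Measure.euclideanHausdorffMeasure (n - 1) s :=
    fun s hs => hmp.measure_preimage hs.nullMeasurableSet
  ext s hs
  rw [Measure.map_apply measurable_neg hs, noise, cond_apply (measurableSet_orthDisk _ _),
    cond_apply (measurableSet_orthDisk _ _), ← hμ _ ((measurableSet_orthDisk ε v).inter hs),
    preimage_inter, hpre]

theorem integral_inner_noise {n : ℕ} (ε : ℝ) (v x : EuclideanSpace ℝ (Fin n)) :
    ∫ z, ⟪x, z⟫ ∂(noise ε v) = 0 := by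
  have h : ∫ z, ⟪x, z⟫ ∂(noise ε v) = -∫ z, ⟪x, z⟫ ∂(noise ε v) := by
    conv_lhs => rw [← noise_map_neg]
    rw [integral_map measurable_neg.aemeasurable (by fun_prop), ← integral_neg]
    simp
  linarith

/-- A reflection exchanges the two noises and preserves the norm; this makes the rate at which the
game ends independent of the chosen directions. -/
theorem integral_norm_sq_noise_eq {n : ℕ} {ε : ℝ} {v w : EuclideanSpace ℝ (Fin n)}
    (h : ‖v‖ = ‖w‖) : ∫ z, ‖z‖ ^ 2 ∂(noise ε v) = ∫ z, ‖z‖ ^ 2 ∂(noise ε w) := by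
  rw [noise_eq_map h, integral_map (LinearIsometryEquiv.continuous _).measurable.aemeasurable
    (by fun_prop)]
  simp

theorem integrable_noise {n : ℕ} {ε : ℝ} (hε : 0 < ε) {v : EuclideanSpace ℝ (Fin n)} (hv : v ≠ 0)
    {f : EuclideanSpace ℝ (Fin n) → ℝ} (hf : Continuous f) : Integrable f (noise ε v) := by
  have := isProbabilityMeasure_noise hε hv
  obtain ⟨C, hC⟩ := (isCompact_closedBall (0 : EuclideanSpace ℝ (Fin n)) ε)
    |>.exists_bound_of_continuousOn hf.continuousOn
  refine Integrable.of_bound hf.aestronglyMeasurable C ?_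
  filter_upwards [ae_mem_orthDisk ε v] with z hz
  exact hC z (by simpa using hz.2)

/-- For n ≥ 2 the disk has dimension at least 1, so its Hausdorff measure has no atom at the origin.
-/
theorem integral_norm_sq_noise_pos {n : ℕ} (hn : 2 ≤ n) {ε : ℝ} (hε : 0 < ε)
    {v : EuclideanSpace ℝ (Fin n)} (hv : v ≠ 0) : 0 < ∫ z, ‖z‖ ^ 2 ∂(noise ε v) := by
  have := isProbabilityMeasure_noise hε hv
  rw [integral_pos_iff_support_of_nonneg (fun z => by positivity)
    (integrable_noise hε hv (by fun_prop))]
  have hs : Function.support (fun z : EuclideanSpace ℝ (Fin n) => ‖z‖ ^ 2) = {0}ᶜ := by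
    ext z
    simp
  have h0 : noise ε v {0} = 0 := by
    have := Measure.nullSingletonClass_hausdorff (EuclideanSpace ℝ (Fin n))
      (d := ((n - 1 : ℕ) : ℝ)) (by exact_mod_cast (by omega : 0 < n - 1))
    refine cond_absolutelyContinuous ?_
    rw [Measure.euclideanHausdorffMeasure_def, Measure.smul_apply, measure_singleton, smul_zero]
  rw [hs, prob_compl_eq_one_sub (measurableSet_singleton 0), h0]
  simp

/-- Near a given direction all the noises are images of one fixed measure under reflections varying
continuously with v, so dominated convergence applies. -/
theorem continuous_integral_noise {n : ℕ} {ε : ℝ} (hε : 0 < ε)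
    {u : EuclideanSpace ℝ (Fin n) → ℝ} (hu : Continuous u) {K : ℝ} (hK : ∀ x, |u x| ≤ K) :
    Continuous fun p : EuclideanSpace ℝ (Fin n) ×
      Metric.sphere (0 : EuclideanSpace ℝ (Fin n)) ε => ∫ z, u (p.1 + z) ∂(noise ε p.2) := by
  rw [continuous_iff_continuousAt]
  rintro ⟨x₁, v₁⟩
  have hv₁ : (v₁ : EuclideanSpace ℝ (Fin n)) ≠ 0 := ne_zero_of_mem_sphere hε.ne' v₁
  have := isProbabilityMeasure_noise hε (neg_ne_zero.2 hv₁)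
  -- The reference measure is the noise at -v₁, not v₁: the reflection taking v₁ to v has axis v₁ -
  -- v, which degenerates at v = v₁, whereas -v₁ - v equals -2v₁ ≠ 0 there.
  let D : Metric.sphere (0 : EuclideanSpace ℝ (Fin n)) ε → EuclideanSpace ℝ (Fin n) :=
    fun v => -(v₁ : EuclideanSpace ℝ (Fin n)) - v
  have hD : Continuous D := by fun_prop
  have hD₁ : D v₁ ≠ 0 := by
    have h : D v₁ = (-2 : ℝ) • (v₁ : EuclideanSpace ℝ (Fin n)) := by simp only [D]; module
    rw [h]
    exact smul_ne_zero (by norm_num) hv₁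
  let R : EuclideanSpace ℝ (Fin n) × Metric.sphere (0 : EuclideanSpace ℝ (Fin n)) ε →
      EuclideanSpace ℝ (Fin n) → ℝ := fun p z =>
    u (p.1 + (Submodule.span ℝ {D p.2})ᗮ.reflection z)
  have heq : (fun p : EuclideanSpace ℝ (Fin n) × Metric.sphere (0 : EuclideanSpace ℝ (Fin n)) ε =>
      ∫ z, u (p.1 + z) ∂(noise ε p.2)) =
      fun p => ∫ z, R p z ∂(noise ε (-(v₁ : EuclideanSpace ℝ (Fin n)))) := by
    funext p
    have hn : ‖-(v₁ : EuclideanSpace ℝ (Fin n))‖ = ‖(p.2 : EuclideanSpace ℝ (Fin n))‖ := by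
      rw [norm_neg, norm_eq_of_mem_sphere, norm_eq_of_mem_sphere]
    rw [noise_eq_map hn, integral_map (LinearIsometryEquiv.continuous _).measurable.aemeasurable
      (by fun_prop)]
  rw [heq]
  refine continuousAt_of_dominated (bound := fun _ => K) ?_ ?_ (integrable_const _) ?_
  · refine Eventually.of_forall fun p => Continuous.aestronglyMeasurable ?_
    exact hu.comp (continuous_const.add (LinearIsometryEquiv.continuous _))
  · exact Eventually.of_forall fun p => Eventually.of_forall fun z => hK _
  · refine Eventually.of_forall fun z => hu.continuousAt.comp ?_
    simp only [Submodule.reflection_orthogonal_apply, Submodule.reflection_singleton_apply,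
      RCLike.ofReal_real_eq_id, id_eq]
    have h1 : ContinuousAt (fun p : EuclideanSpace ℝ (Fin n) ×
      Metric.sphere (0 : EuclideanSpace ℝ (Fin n)) ε => D p.2) (x₁, v₁) := by fun_prop
    have h2 : ContinuousAt (fun p : EuclideanSpace ℝ (Fin n) ×
      Metric.sphere (0 : EuclideanSpace ℝ (Fin n)) ε => ⟪D p.2, z⟫ / ‖D p.2‖ ^ 2) (x₁, v₁) :=
      ContinuousAt.div (by fun_prop) (by fun_prop) (by simpa using hD₁)
    exact continuousAt_fst.add (((h2.smul h1).const_smul 2).sub continuousAt_const).neg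

/-- A continuous function of a point and a parameter in a compact metric space admits a measurable
choice of nearly maximizing parameters. -/
theorem exists_measurable_iSup_sub_le {X Y : Type*} [TopologicalSpace X] [MeasurableSpace X]
    [OpensMeasurableSpace X] [TopologicalSpace Y] [CompactSpace Y]
    [TopologicalSpace.SeparableSpace Y] [Nonempty Y] [MeasurableSpace Y]
    {g : X → Y → ℝ} (hg : Continuous fun p : X × Y => g p.1 p.2) {η : ℝ} (hη : 0 < η) :
    ∃ s : X → Y, Measurable s ∧ ∀ x, (⨆ y, g x y) - η ≤ g x (s x) := by
  classical
  have hsup : Continuous fun x => ⨆ y, g x y := by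
    simpa [iSup, image_univ] using isCompact_univ.continuous_sSup (f := g) hg
  -- The strict inequality is open in y, so a dense sequence meets it. The first index that works is
  -- measurable in x, and a choice factoring through ℕ is measurable for any σ-algebra on `Y`.
  have hex : ∀ x, ∃ N, (⨆ y, g x y) - η < g x (TopologicalSpace.denseSeq Y N) := by
    intro x
    obtain ⟨y, hy⟩ := exists_lt_of_lt_ciSup (f := g x) (sub_lt_self (⨆ y, g x y) hη)
    have hopen : IsOpen {y | (⨆ y, g x y) - η < g x y} :=
      isOpen_lt continuous_const (hg.comp (Continuous.prodMk_right x))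
    obtain ⟨_, hz, N, rfl⟩ :=
      (TopologicalSpace.denseRange_denseSeq Y).inter_open_nonempty _ hopen ⟨y, hy⟩
    exact ⟨N, hz⟩
  refine ⟨fun x => TopologicalSpace.denseSeq Y (Nat.find (hex x)), ?_, fun x =>
    (Nat.find_spec (hex x)).le⟩
  refine (measurable_from_nat (f := TopologicalSpace.denseSeq Y)).comp
    (measurable_find hex fun N => ?_)
  exact (isOpen_lt (hsup.sub continuous_const) (hg.comp (Continuous.prodMk_left _))).measurableSet

/-- A preconnected set that meets an open set and its complement meets its frontier. -/
theorem exists_mem_frontier_of_isPreconnected {X : Type*} [TopologicalSpace X] {s t : Set X}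
    (hs : IsOpen s) (ht : IsPreconnected t) (h1 : (t ∩ s).Nonempty) (h2 : (t ∩ sᶜ).Nonempty) :
    (t ∩ frontier s).Nonempty := by
  by_contra hne
  have hfr : ∀ y ∈ t, y ∈ closure s → y ∈ s := fun y hy hc => by
    by_contra hys
    exact hne ⟨y, hy, by rw [hs.frontier_eq]; exact ⟨hc, hys⟩⟩
  obtain ⟨y, hy, hy'⟩ := h2
  obtain ⟨w, _, hw, hw'⟩ := ht s (closure s)ᶜ hs isClosed_closure.isOpen_compl
    (fun w hw => by_cases (fun h : w ∈ closure s => Or.inl (hfr w hw h)) Or.inr) h1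
    ⟨y, hy, fun hc => hy' (hfr y hy hc)⟩
  exact hw' (subset_closure hw)

namespace Data

variable {n : ℕ} (G : Data n)

/-! ### Geometry of the thickened domain -/

theorem cutoff_of_notMem {x : EuclideanSpace ℝ (Fin n)} (hx : x ∉ G.Ω) : G.cutoff x = 1 := by
  simp [cutoff, hx]

/-- There is no jump at ∂Ω: inside, δ is max(0, 1 - dist/ε), which tends to the outside value 1 as
the distance vanishes. -/
theorem continuous_cutoff : Continuous G.cutoff := by
  classical
  have h : G.cutoff = fun x => if x ∈ G.Ω then
      max 0 (1 - G.ε⁻¹ * Metric.infDist x (frontier G.Ω)) else 1 := by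
    funext x
    unfold cutoff
    have hε := G.ε_pos
    split_ifs with h1 h2
    · rw [max_eq_right]
      rw [sub_nonneg, inv_mul_le_one₀ hε]
      exact h2
    · rw [max_eq_left]
      rw [sub_nonpos, one_le_inv_mul₀ hε]
      exact (not_le.1 h2).le
    · rfl
  rw [h]
  refine Continuous.if (fun a ha => ?_) ?_ continuous_const
  · rw [Metric.infDist_zero_of_mem (show a ∈ frontier G.Ω from ha)]
    simp
  · exact continuous_const.max
      (continuous_const.sub (continuous_const.mul (Metric.continuous_infDist_pt _)))

/-- If the segment from x to x + z leaves Ω, it crosses ∂Ω at a point within ε of x + z. -/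
theorem add_mem_thick {x z : EuclideanSpace ℝ (Fin n)} (hx : x ∈ G.Ω) (hz : ‖z‖ ≤ G.ε) :
    x + z ∈ G.thick := by
  by_cases h : x + z ∈ G.Ω
  · exact Or.inl h
  refine Or.inr ⟨h, ?_⟩
  obtain ⟨y, hy, hyf⟩ := exists_mem_frontier_of_isPreconnected G.isOpen
    (convex_segment (𝕜 := ℝ) x (x + z)).isPreconnected
    ⟨x, left_mem_segment ℝ _ _, hx⟩ ⟨x + z, right_mem_segment ℝ _ _, h⟩
  have hsub : segment ℝ x (x + z) ⊆ Metric.closedBall (x + z) G.ε :=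
    (convex_closedBall _ _).segment_subset (by simpa [dist_eq_norm] using hz)
      (Metric.mem_closedBall_self G.ε_pos.le)
  refine (Metric.infDist_le_dist_of_mem hyf).trans ?_
  rw [dist_comm]
  exact hsub hy

theorem cutoff_eq_zero_or_mem_strip {x : EuclideanSpace ℝ (Fin n)} (hx : x ∈ G.thick) :
    G.cutoff x = 0 ∨ x ∈ G.strip := by
  by_cases h : Metric.infDist x (frontier G.Ω) ≤ G.ε
  · exact Or.inr h
  · rcases hx with hx | hx
    · left
      simp [cutoff, hx, h]
    · exact absurd hx.2 h

theorem frontier_nonempty (hn : 2 ≤ n) : (frontier G.Ω).Nonempty := by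
  have : Nonempty (Fin n) := ⟨⟨0, by omega⟩⟩
  rw [nonempty_iff_ne_empty, Ne, frontier_eq_empty_iff, not_or]
  refine ⟨G.isConnected.nonempty.ne_empty, fun h => ?_⟩
  exact NormedSpace.unbounded_univ ℝ (EuclideanSpace ℝ (Fin n)) (h ▸ G.isBounded)

/-- Nonemptiness of ∂Ω matters: `Metric.infDist` to the empty set is 0, which would make the strip
the whole space. -/
theorem isCompact_strip (hn : 2 ≤ n) : IsCompact G.strip := by
  have hf : IsCompact (frontier G.Ω) :=
    Metric.isCompact_of_isClosed_isBounded isClosed_frontier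
      (G.isBounded.closure.subset frontier_subset_closure)
  refine (hf.cthickening (r := G.ε)).of_isClosed_subset
    (isClosed_le (Metric.continuous_infDist_pt _) continuous_const) fun x hx => ?_
  rw [Metric.mem_cthickening_iff]
  exact ENNReal.le_ofReal_iff_toReal_le (Metric.infEDist_ne_top (G.frontier_nonempty hn))
    G.ε_pos.le |>.2 hx

theorem strip_nonempty (hn : 2 ≤ n) : G.strip.Nonempty := by
  obtain ⟨x, hx⟩ := G.frontier_nonempty hn
  exact ⟨x, by simp [strip, Metric.infDist_zero_of_mem hx, G.ε_pos.le]⟩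

/-- The boundary data extend to a bounded continuous function with the same supremum. -/
theorem exists_extension (hn : 2 ≤ n) :
    ∃ C : EuclideanSpace ℝ (Fin n) → ℝ, Continuous C ∧ (∀ x ∈ G.strip, C x = G.F x) ∧
      (∀ x, C x ≤ sSup (G.F '' G.strip)) ∧
      ∃ K, (∀ x, |C x| ≤ K) ∧ |sSup (G.F '' G.strip)| ≤ K := by
  obtain ⟨L, hL⟩ := G.lipschitz
  obtain ⟨g, hg, hgF⟩ := hL.extend_real
  have hgF : EqOn G.F g G.strip := hgF
  have himg : G.F '' G.strip = g '' G.strip := hgF.image_eq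
  have hcpt : IsCompact (G.F '' G.strip) :=
    himg ▸ (G.isCompact_strip hn).image hg.continuous
  have hm : ∀ x ∈ G.strip, sInf (G.F '' G.strip) ≤ G.F x := fun x hx =>
    csInf_le hcpt.bddBelow (mem_image_of_mem _ hx)
  have hM : ∀ x ∈ G.strip, G.F x ≤ sSup (G.F '' G.strip) := fun x hx =>
    le_csSup hcpt.bddAbove (mem_image_of_mem _ hx)
  obtain ⟨x₀, hx₀⟩ := G.strip_nonempty hn
  have hmM := (hm x₀ hx₀).trans (hM x₀ hx₀)
  generalize sInf (G.F '' G.strip) = m at *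
  generalize sSup (G.F '' G.strip) = M at *
  -- Clamping the Lipschitz extension between inf F and sup F makes it bounded and keeps it below
  -- the starting constant, which the monotonicity of the iterates requires.
  refine ⟨fun x => max m (min M (g x)), continuous_const.max (continuous_const.min hg.continuous),
    fun x hx => ?_, fun x => max_le hmM (min_le_left _ _), max |m| |M|, fun x => ?_,
    le_max_right _ _⟩
  · dsimp only
    rw [← hgF hx, min_eq_right (hM x hx), max_eq_right (hm x hx)]
  · rw [abs_le]
    constructor
    · have := neg_abs_le m
      have := le_max_left |m| |M|
      have := le_max_left m (min M (g x))
      linarith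
    · exact (max_le hmM (min_le_left _ _)).trans ((le_abs_self M).trans (le_max_right _ _))

/-! ### Averages -/

theorem integrable_comp_add_noise {u : EuclideanSpace ℝ (Fin n) → ℝ} (hu : Continuous u)
    (x : EuclideanSpace ℝ (Fin n)) (v : Metric.sphere (0 : EuclideanSpace ℝ (Fin n)) G.ε) :
    Integrable (fun z => u (x + z)) (noise G.ε v) :=
  integrable_noise G.ε_pos (ne_zero_of_mem_sphere G.ε_pos.ne' v) (by fun_prop)

theorem average_const (c : ℝ) (x : EuclideanSpace ℝ (Fin n))
    (v : Metric.sphere (0 : EuclideanSpace ℝ (Fin n)) G.ε) :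
    G.average (fun _ => c) x v = c := by
  have := isProbabilityMeasure_noise G.ε_pos (ne_zero_of_mem_sphere G.ε_pos.ne' v)
  simp only [average, integral_const, probReal_univ, one_smul]
  rw [← add_mul, G.α_add_β, one_mul]

theorem average_mono {u w : EuclideanSpace ℝ (Fin n) → ℝ} (hu : Continuous u) (hw : Continuous w)
    (h : ∀ x, u x ≤ w x) (x : EuclideanSpace ℝ (Fin n))
    (v : Metric.sphere (0 : EuclideanSpace ℝ (Fin n)) G.ε) :
    G.average u x v ≤ G.average w x v := by
  unfold average
  have h1 := mul_le_mul_of_nonneg_left (h (x + v)) G.α_nonneg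
  have h2 := mul_le_mul_of_nonneg_left (integral_mono (G.integrable_comp_add_noise hu x v)
    (G.integrable_comp_add_noise hw x v) fun z => h (x + z)) G.β_pos.le
  exact add_le_add h1 h2

theorem abs_average_le {u : EuclideanSpace ℝ (Fin n) → ℝ} (hu : Continuous u) {K : ℝ}
    (hK : ∀ x, |u x| ≤ K) (x : EuclideanSpace ℝ (Fin n))
    (v : Metric.sphere (0 : EuclideanSpace ℝ (Fin n)) G.ε) : |G.average u x v| ≤ K := by
  have h1 := G.average_mono continuous_const hu (fun x => (abs_le.1 (hK x)).1) x v
  have h2 := G.average_mono hu continuous_const (fun x => (abs_le.1 (hK x)).2) x v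
  rw [average_const] at h1 h2
  exact abs_le.2 ⟨h1, h2⟩

theorem continuous_average {u : EuclideanSpace ℝ (Fin n) → ℝ} (hu : Continuous u) {K : ℝ}
    (hK : ∀ x, |u x| ≤ K) :
    Continuous fun p : EuclideanSpace ℝ (Fin n) ×
      Metric.sphere (0 : EuclideanSpace ℝ (Fin n)) G.ε => G.average u p.1 p.2 := by
  unfold average
  have h1 : Continuous fun p : EuclideanSpace ℝ (Fin n) ×
      Metric.sphere (0 : EuclideanSpace ℝ (Fin n)) G.ε => u (p.1 + p.2) := by fun_prop
  exact (continuous_const.mul h1).add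
    (continuous_const.mul (continuous_integral_noise G.ε_pos hu hK))

theorem nonempty_sphere (hn : 2 ≤ n) :
    Nonempty (Metric.sphere (0 : EuclideanSpace ℝ (Fin n)) G.ε) := by
  have : Nonempty (Fin n) := ⟨⟨0, by omega⟩⟩
  exact (NormedSpace.sphere_nonempty.2 G.ε_pos.le).to_subtype

/-! ### The operator with continuous boundary data -/

/-- The dynamic programming operator with the boundary data replaced by the function `C`. -/
noncomputable def opWith (C u : EuclideanSpace ℝ (Fin n) → ℝ) (x : EuclideanSpace ℝ (Fin n)) : ℝ :=
  (1 - G.cutoff x) / 2 *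
      ((⨆ v : Metric.sphere (0 : EuclideanSpace ℝ (Fin n)) G.ε, G.average u x v) +
        ⨅ v : Metric.sphere (0 : EuclideanSpace ℝ (Fin n)) G.ε, G.average u x v) +
    G.cutoff x * C x

/-- The iterates of `opWith C` started from the constant `M`. -/
noncomputable def iterateWith (C : EuclideanSpace ℝ (Fin n) → ℝ) (M : ℝ) (k : ℕ) :
    EuclideanSpace ℝ (Fin n) → ℝ :=
  (G.opWith C)^[k] fun _ => M

theorem iterateWith_zero (C : EuclideanSpace ℝ (Fin n) → ℝ) (M : ℝ) :
    G.iterateWith C M 0 = fun _ => M := rfl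

theorem iterateWith_succ (C : EuclideanSpace ℝ (Fin n) → ℝ) (M : ℝ) (k : ℕ) :
    G.iterateWith C M (k + 1) = G.opWith C (G.iterateWith C M k) :=
  Function.iterate_succ_apply' _ _ _

theorem bddAbove_average {u : EuclideanSpace ℝ (Fin n) → ℝ} (hu : Continuous u) {K : ℝ}
    (hK : ∀ x, |u x| ≤ K) (x : EuclideanSpace ℝ (Fin n)) :
    BddAbove (range fun v : Metric.sphere (0 : EuclideanSpace ℝ (Fin n)) G.ε =>
      G.average u x v) :=
  ⟨K, by rintro _ ⟨v, rfl⟩; exact (abs_le.1 (G.abs_average_le hu hK x v)).2⟩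

theorem bddBelow_average {u : EuclideanSpace ℝ (Fin n) → ℝ} (hu : Continuous u) {K : ℝ}
    (hK : ∀ x, |u x| ≤ K) (x : EuclideanSpace ℝ (Fin n)) :
    BddBelow (range fun v : Metric.sphere (0 : EuclideanSpace ℝ (Fin n)) G.ε =>
      G.average u x v) :=
  ⟨-K, by rintro _ ⟨v, rfl⟩; exact (abs_le.1 (G.abs_average_le hu hK x v)).1⟩

theorem opWith_mono {C u w : EuclideanSpace ℝ (Fin n) → ℝ} (hu : Continuous u) (hw : Continuous w)
    {K : ℝ} (hKu : ∀ x, |u x| ≤ K) (hKw : ∀ x, |w x| ≤ K) (h : ∀ x, u x ≤ w x)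
    (x : EuclideanSpace ℝ (Fin n)) : G.opWith C u x ≤ G.opWith C w x := by
  have h1 := ciSup_mono (G.bddAbove_average hw hKw x) (G.average_mono hu hw h x)
  have h2 := ciInf_mono (G.bddBelow_average hu hKu x) (G.average_mono hu hw h x)
  have h3 : 0 ≤ (1 - G.cutoff x) / 2 := by linarith [(G.cutoff_mem x).2]
  exact add_le_add_left (mul_le_mul_of_nonneg_left (add_le_add h1 h2) h3) _

theorem opWith_const (hn : 2 ≤ n) (C : EuclideanSpace ℝ (Fin n) → ℝ) (c : ℝ)
    (x : EuclideanSpace ℝ (Fin n)) :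
    G.opWith C (fun _ => c) x = (1 - G.cutoff x) * c + G.cutoff x * C x := by
  have := G.nonempty_sphere hn
  simp only [opWith, average_const, ciSup_const, ciInf_const]
  ring

/-- Monotonicity allows comparison with the constants ±K, on which the operator is a convex
combination with C. -/
theorem abs_opWith_le (hn : 2 ≤ n) {C u : EuclideanSpace ℝ (Fin n) → ℝ} (hu : Continuous u)
    {K : ℝ} (hC : ∀ x, |C x| ≤ K) (hK : ∀ x, |u x| ≤ K) (x : EuclideanSpace ℝ (Fin n)) :
    |G.opWith C u x| ≤ K := by
  have hδ := G.cutoff_mem x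
  have hCx := abs_le.1 (hC x)
  have hK0 : 0 ≤ K := (abs_nonneg _).trans (hC x)
  have hK1 : ∀ c, |c| = K → ∀ _ : EuclideanSpace ℝ (Fin n), |c| ≤ K := fun c hc _ => hc.le
  have h1 := G.opWith_mono (C := C) hu continuous_const hK
    (hK1 K (abs_of_nonneg hK0)) (fun x => (abs_le.1 (hK x)).2) x
  have h2 := G.opWith_mono (C := C) continuous_const hu
    (hK1 (-K) (by rw [abs_neg, abs_of_nonneg hK0])) hK (fun x => (abs_le.1 (hK x)).1) x
  rw [opWith_const _ hn] at h1 h2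
  rw [abs_le]
  constructor <;> nlinarith

theorem continuous_opWith {C u : EuclideanSpace ℝ (Fin n) → ℝ} (hC : Continuous C)
    (hu : Continuous u) {K : ℝ} (hK : ∀ x, |u x| ≤ K) : Continuous (G.opWith C u) := by
  have hg := G.continuous_average hu hK
  have hsup : Continuous fun x =>
      ⨆ v : Metric.sphere (0 : EuclideanSpace ℝ (Fin n)) G.ε, G.average u x v := by
    simpa [iSup, image_univ] using isCompact_univ.continuous_sSup
      (f := fun x (v : Metric.sphere (0 : EuclideanSpace ℝ (Fin n)) G.ε) => G.average u x v) hg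
  have hinf : Continuous fun x =>
      ⨅ v : Metric.sphere (0 : EuclideanSpace ℝ (Fin n)) G.ε, G.average u x v := by
    simpa [iInf, image_univ] using isCompact_univ.continuous_sInf
      (f := fun x (v : Metric.sphere (0 : EuclideanSpace ℝ (Fin n)) G.ε) => G.average u x v) hg
  have hδ := G.continuous_cutoff
  unfold opWith
  fun_prop

theorem continuous_iterateWith_and_abs_le (hn : 2 ≤ n) {C : EuclideanSpace ℝ (Fin n) → ℝ}
    (hC : Continuous C) {K M : ℝ} (hK : ∀ x, |C x| ≤ K) (hM : |M| ≤ K) (k : ℕ) :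
    Continuous (G.iterateWith C M k) ∧ ∀ x, |G.iterateWith C M k x| ≤ K := by
  induction k with
  | zero => exact ⟨continuous_const, fun _ => hM⟩
  | succ k ih =>
    rw [iterateWith_succ]
    exact ⟨G.continuous_opWith hC ih.1 ih.2, G.abs_opWith_le hn ih.1 hK ih.2⟩

theorem antitone_iterateWith (hn : 2 ≤ n) {C : EuclideanSpace ℝ (Fin n) → ℝ}
    (hC : Continuous C) {K M : ℝ} (hK : ∀ x, |C x| ≤ K) (hM : |M| ≤ K) (hCM : ∀ x, C x ≤ M)
    (x : EuclideanSpace ℝ (Fin n)) : Antitone fun k => G.iterateWith C M k x := by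
  have h := G.continuous_iterateWith_and_abs_le hn hC hK hM
  refine antitone_nat_of_succ_le fun k => ?_
  induction k generalizing x with
  | zero =>
    rw [iterateWith_succ, iterateWith_zero, opWith_const _ hn]
    have := mul_le_mul_of_nonneg_left (hCM x) (G.cutoff_mem x).1
    linarith
  | succ k ih =>
    have := G.opWith_mono (C := C) (h (k + 1)).1 (h k).1 (h (k + 1)).2 (h k).2 ih x
    rwa [← iterateWith_succ, ← iterateWith_succ] at this

/-- From Ω every move stays in the thickened domain, and off Ω the factor 1 - δ vanishes, so values
outside the thickened domain never enter. -/
theorem upperIterate_eq_iterateWith {C : EuclideanSpace ℝ (Fin n) → ℝ}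
    (hC : ∀ x ∈ G.strip, C x = G.F x) (k : ℕ) :
    ∀ x ∈ G.thick, G.upperIterate k x = G.iterateWith C (sSup (G.F '' G.strip)) k x := by
  induction k with
  | zero => exact fun _ _ => rfl
  | succ k ih =>
    intro x hx
    have hsucc : G.upperIterate (k + 1) = G.op (G.upperIterate k) :=
      Function.iterate_succ_apply' _ _ _
    rw [hsucc, iterateWith_succ]
    generalize G.upperIterate k = u at ih
    generalize G.iterateWith C (sSup (G.F '' G.strip)) k = w at ih
    have hF : G.cutoff x * G.F x = G.cutoff x * C x := by
      rcases G.cutoff_eq_zero_or_mem_strip hx with h | h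
      · simp [h]
      · rw [hC x h]
    unfold op opWith
    rw [hF]
    by_cases hΩ : x ∈ G.Ω
    · have havg : ∀ v : Metric.sphere (0 : EuclideanSpace ℝ (Fin n)) G.ε,
          G.average u x v = G.average w x v := by
        intro v
        have h1 : u (x + v) = w (x + v) :=
          ih (x + v) (G.add_mem_thick hΩ (norm_eq_of_mem_sphere v).le)
        have h2 : ∫ z, u (x + z) ∂(noise G.ε v) = ∫ z, w (x + z) ∂(noise G.ε v) := by
          refine integral_congr_ae ?_
          filter_upwards [ae_mem_orthDisk G.ε (v : EuclideanSpace ℝ (Fin n))] with z hz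
          exact ih (x + z) (G.add_mem_thick hΩ hz.2)
        unfold average
        rw [h1, h2]
      simp only [havg]
    · simp [G.cutoff_of_notMem hΩ]

/-! ### One step of the game -/

/-- The function on states that is `a` before the end of the game and `d` afterwards. -/
noncomputable def stateFun (a d : EuclideanSpace ℝ (Fin n) → ℝ) (s : State G) : ℝ :=
  if s.2 = true then d s.1 else a s.1

theorem measurable_stateFun {a d : EuclideanSpace ℝ (Fin n) → ℝ} (ha : Measurable a)
    (hd : Measurable d) : Measurable (G.stateFun a d) :=
  Measurable.ite (measurable_snd (measurableSet_singleton true)) (hd.comp measurable_fst)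
    (ha.comp measurable_fst)

theorem abs_stateFun_le {a d : EuclideanSpace ℝ (Fin n) → ℝ} {K : ℝ} (ha : ∀ x, |a x| ≤ K)
    (hd : ∀ x, |d x| ≤ K) (s : State G) : |G.stateFun a d s| ≤ K := by
  unfold stateFun
  split_ifs
  exacts [hd _, ha _]

theorem integral_moveLaw {a : EuclideanSpace ℝ (Fin n) → ℝ} (ha : Continuous a)
    (x : EuclideanSpace ℝ (Fin n)) (v : Metric.sphere (0 : EuclideanSpace ℝ (Fin n)) G.ε) :
    ∫ y, a y ∂(G.moveLaw x v) = G.average a x v := by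
  have hadd : Measurable fun z : EuclideanSpace ℝ (Fin n) => x + z := by fun_prop
  have hint : Integrable a ((noise G.ε (v : EuclideanSpace ℝ (Fin n))).map fun z => x + z) :=
    (integrable_map_measure ha.aestronglyMeasurable hadd.aemeasurable).2
      (G.integrable_comp_add_noise ha x v)
  rw [moveLaw, integral_add_measure
    ((integrable_dirac (by simp)).smul_measure ENNReal.ofReal_ne_top)
    (hint.smul_measure ENNReal.ofReal_ne_top), integral_smul_measure, integral_smul_measure,
    integral_dirac, integral_map hadd.aemeasurable ha.aestronglyMeasurable,
    ENNReal.toReal_ofReal G.α_nonneg, ENNReal.toReal_ofReal G.β_pos.le]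
  rfl

theorem integrable_of_abs_le {Ω : Type*} [MeasurableSpace Ω] {μ : Measure Ω} [IsFiniteMeasure μ]
    {f : Ω → ℝ} (hf : Measurable f) {K : ℝ} (hK : ∀ x, |f x| ≤ K) : Integrable f μ :=
  Integrable.of_bound hf.aestronglyMeasurable K (Eventually.of_forall hK)

theorem integral_stepLaw_of_ended (S T : Strategy G) {k : ℕ} {h : Finset.Iic k → State G}
    (hh : (current h).2 = true) (f : State G → ℝ) :
    ∫ s, f s ∂(G.stepLaw S T k h) = f (current h) := by
  rw [stepLaw, if_pos hh, integral_dirac]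

theorem integral_stepLaw (S T : Strategy G) {k : ℕ} {h : Finset.Iic k → State G}
    (hh : ¬ (current h).2 = true) {a d : EuclideanSpace ℝ (Fin n) → ℝ} (ha : Continuous a)
    (hd : Continuous d) {K : ℝ} (haK : ∀ x, |a x| ≤ K) (hdK : ∀ x, |d x| ≤ K) :
    ∫ s, G.stateFun a d s ∂(G.stepLaw S T k h) =
      G.cutoff (current h).1 * d (current h).1 +
        (1 - G.cutoff (current h).1) *
          (2⁻¹ * G.average a (current h).1 (S.move k (positions h)) +
            2⁻¹ * G.average a (current h).1 (T.move k (positions h))) := by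
  have hm : Measurable fun y : EuclideanSpace ℝ (Fin n) => (y, false) := by fun_prop
  have hf := G.measurable_stateFun ha.measurable hd.measurable
  have hfK := G.abs_stateFun_le haK hdK
  have hδ := G.cutoff_mem (current h).1
  have hS := G.isProbabilityMeasure_moveLaw (current h).1 (S.move k (positions h))
  have hT := G.isProbabilityMeasure_moveLaw (current h).1 (T.move k (positions h))
  have hint : ∀ μ : Measure (State G), IsFiniteMeasure μ → Integrable (G.stateFun a d) μ :=
    fun μ _ => integrable_of_abs_le hf hfK
  have hhalf : (2⁻¹ : ℝ≥0∞) ≠ ⊤ := by simp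
  have hmove : ∀ v : Metric.sphere (0 : EuclideanSpace ℝ (Fin n)) G.ε,
      ∫ s, G.stateFun a d s ∂((G.moveLaw (current h).1 v).map fun y => (y, false)) =
        G.average a (current h).1 v := by
    intro v
    rw [integral_map hm.aemeasurable hf.aestronglyMeasurable, ← G.integral_moveLaw ha]
    simp [stateFun]
  have i1 := (hint _ (Measure.isFiniteMeasure_map
    (G.moveLaw (current h).1 (S.move k (positions h))) fun y => (y, false))).smul_measure hhalf
  have i2 := (hint _ (Measure.isFiniteMeasure_map
    (G.moveLaw (current h).1 (T.move k (positions h))) fun y => (y, false))).smul_measure hhalf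
  rw [stepLaw, if_neg hh, integral_add_measure
    ((hint _ inferInstance).smul_measure ENNReal.ofReal_ne_top)
    ((i1.add_measure i2).smul_measure ENNReal.ofReal_ne_top), integral_smul_measure,
    integral_smul_measure, integral_add_measure i1 i2, integral_smul_measure,
    integral_smul_measure, integral_dirac, hmove, hmove, ENNReal.toReal_ofReal hδ.1,
    ENNReal.toReal_ofReal (by linarith), ENNReal.toReal_inv]
  simp [stateFun]

/-- The states that the game can reach. -/
def reachable : Set (State G) :=
  {s | (s.2 = true → s.1 ∈ G.strip) ∧ (s.2 = false → s.1 ∈ G.thick)}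

theorem isClosed_strip : IsClosed G.strip :=
  isClosed_le (Metric.continuous_infDist_pt _) continuous_const

theorem measurableSet_thick : MeasurableSet G.thick :=
  G.isOpen.measurableSet.union (G.isOpen.measurableSet.compl.inter G.isClosed_strip.measurableSet)

theorem measurableSet_reachable : MeasurableSet G.reachable := by
  have h1 : MeasurableSet {s : State G | s.2 = true} :=
    measurable_snd (measurableSet_singleton true)
  have h2 : MeasurableSet {s : State G | s.2 = false} :=
    measurable_snd (measurableSet_singleton false)
  have h3 : MeasurableSet {s : State G | s.1 ∈ G.strip} :=
    measurable_fst G.isClosed_strip.measurableSet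
  have h4 : MeasurableSet {s : State G | s.1 ∈ G.thick} :=
    measurable_fst G.measurableSet_thick
  exact (h1.imp h3).inter (h2.imp h4)

theorem ae_moveLaw_mem_thick {x : EuclideanSpace ℝ (Fin n)} (hx : x ∈ G.Ω)
    (v : Metric.sphere (0 : EuclideanSpace ℝ (Fin n)) G.ε) :
    ∀ᵐ y ∂(G.moveLaw x v), y ∈ G.thick := by
  have hadd : Measurable fun z : EuclideanSpace ℝ (Fin n) => x + z := by fun_prop
  rw [moveLaw, ae_add_measure_iff]
  refine ⟨Measure.ae_smul_measure ?_ _, Measure.ae_smul_measure ?_ _⟩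
  · refine (ae_dirac_iff (p := fun y => y ∈ G.thick) G.measurableSet_thick).2 ?_
    exact G.add_mem_thick hx (norm_eq_of_mem_sphere v).le
  · refine (ae_map_iff (p := fun y => y ∈ G.thick) hadd.aemeasurable G.measurableSet_thick).2 ?_
    filter_upwards [ae_mem_orthDisk G.ε (v : EuclideanSpace ℝ (Fin n))] with z hz
    exact G.add_mem_thick hx hz.2

/-- The game ends only where δ > 0, hence in the strip; it moves on only from Ω, since δ = 1
elsewhere. -/
theorem ae_stepLaw_reachable (S T : Strategy G) {k : ℕ} (h : Finset.Iic k → State G)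
    (hh : current h ∈ G.reachable) : ∀ᵐ s ∂(G.stepLaw S T k h), s ∈ G.reachable := by
  have hm : Measurable fun y : EuclideanSpace ℝ (Fin n) => (y, false) := by fun_prop
  unfold stepLaw
  split_ifs with hc
  · exact (ae_dirac_iff (p := fun s => s ∈ G.reachable) G.measurableSet_reachable).2 hh
  have hx := hh.2 (by simpa using hc)
  rw [ae_add_measure_iff]
  constructor
  · rcases G.cutoff_eq_zero_or_mem_strip hx with h0 | h0
    · simp [h0]
    · refine Measure.ae_smul_measure ?_ _
      refine (ae_dirac_iff (p := fun s => s ∈ G.reachable) G.measurableSet_reachable).2 ?_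
      simpa [reachable] using h0
  · by_cases hΩ : (current h).1 ∈ G.Ω
    · have hmove : ∀ v : Metric.sphere (0 : EuclideanSpace ℝ (Fin n)) G.ε,
          ∀ᵐ s ∂((G.moveLaw (current h).1 v).map fun y => (y, false)), s ∈ G.reachable := by
        intro v
        refine (ae_map_iff (p := fun s => s ∈ G.reachable) hm.aemeasurable
          G.measurableSet_reachable).2 ?_
        filter_upwards [G.ae_moveLaw_mem_thick hΩ v] with y hy
        simpa [reachable] using hy
      refine Measure.ae_smul_measure ?_ _
      rw [ae_add_measure_iff]
      exact ⟨Measure.ae_smul_measure (hmove _) _, Measure.ae_smul_measure (hmove _) _⟩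
    · simp [G.cutoff_of_notMem hΩ]

/-! ### The law of the trajectory -/

instance (S T : Strategy G) (x : EuclideanSpace ℝ (Fin n)) :
    IsProbabilityMeasure (G.law S T x) := by
  unfold law
  infer_instance

/-- The Ionescu-Tulcea construction, one step at a time: given the history, the next state follows
the step kernel. Every statement about trajectories below reduces to a single step through this
identity. -/
theorem map_law_succ (S T : Strategy G) (x : EuclideanSpace ℝ (Fin n)) (k : ℕ) :
    (G.law S T x).map (fun ω => (Preorder.frestrictLe k ω, ω (k + 1))) =
      (G.law S T x).map (Preorder.frestrictLe k) ⊗ₘ G.stepKernel S T k := by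
  have h1 := Kernel.partialTraj_compProd_eq_map_traj (X := fun _ => State G)
    (κ := G.stepKernel S T) (Nat.zero_le k) (x₀ := fun _ => (x, false))
  have h2 := Kernel.traj_map_frestrictLe_apply (X := fun _ => State G)
    (κ := G.stepKernel S T) 0 k fun _ => (x, false)
  unfold law
  rw [h2]
  exact h1.symm

theorem integral_law_succ (S T : Strategy G) (x : EuclideanSpace ℝ (Fin n)) (k : ℕ)
    {f : State G → ℝ} (hf : Measurable f) {K : ℝ} (hK : ∀ s, |f s| ≤ K) :
    ∫ ω, f (ω (k + 1)) ∂(G.law S T x) =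
      ∫ ω, ∫ s, f s ∂(G.stepLaw S T k (Preorder.frestrictLe k ω)) ∂(G.law S T x) := by
  have hr : Measurable (Preorder.frestrictLe (π := fun _ => State G) k) := by fun_prop
  have hp : Measurable fun ω : ℕ → State G =>
      (Preorder.frestrictLe (π := fun _ => State G) k ω, ω (k + 1)) := by
    fun_prop
  have hfs : Measurable fun p : (Finset.Iic k → State G) × State G => f p.2 :=
    hf.comp measurable_snd
  have : IsProbabilityMeasure ((G.law S T x).map (Preorder.frestrictLe k)) :=
    Measure.isProbabilityMeasure_map hr.aemeasurable
  have hint : Integrable (fun p : (Finset.Iic k → State G) × State G => f p.2)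
      ((G.law S T x).map (Preorder.frestrictLe k) ⊗ₘ G.stepKernel S T k) :=
    integrable_of_abs_le hfs fun p => hK p.2
  have h1 := integral_map (μ := G.law S T x) hp.aemeasurable hfs.aestronglyMeasurable
  rw [map_law_succ, Measure.integral_compProd hint, integral_map hr.aemeasurable] at h1
  · exact h1.symm
  · exact (hf.stronglyMeasurable.integral_kernel (κ := G.stepKernel S T k)).aestronglyMeasurable

theorem ae_law_zero (S T : Strategy G) (x : EuclideanSpace ℝ (Fin n)) :
    ∀ᵐ ω ∂(G.law S T x), ω 0 = (x, false) := by
  have hr : Measurable (Preorder.frestrictLe (π := fun _ => State G) 0) := by fun_prop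
  have h : (G.law S T x).map (Preorder.frestrictLe (π := fun _ => State G) 0) =
      Measure.dirac fun _ => (x, false) := by
    unfold law
    rw [Kernel.traj_map_frestrictLe_apply, Kernel.partialTraj_self, Kernel.id_apply]
  have h2 : ∀ᵐ y ∂((G.law S T x).map (Preorder.frestrictLe (π := fun _ => State G) 0)),
      current y = (x, false) := by
    rw [h, ae_dirac_iff]
    · rfl
    · exact (measurable_pi_apply _ : Measurable (current (G := G) (k := 0)))
        (measurableSet_singleton _)
  exact ae_of_ae_map hr.aemeasurable h2

theorem ae_law_succ (S T : Strategy G) (x : EuclideanSpace ℝ (Fin n)) (k : ℕ)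
    {p : State G × State G → Prop} (hp : MeasurableSet {q | p q})
    (h : ∀ᵐ ω ∂(G.law S T x), ∀ᵐ s ∂(G.stepLaw S T k (Preorder.frestrictLe k ω)), p (ω k, s)) :
    ∀ᵐ ω ∂(G.law S T x), p (ω k, ω (k + 1)) := by
  have hr : Measurable (Preorder.frestrictLe (π := fun _ => State G) k) := by fun_prop
  have hpair : Measurable fun ω : ℕ → State G =>
    (Preorder.frestrictLe (π := fun _ => State G) k ω, ω (k + 1)) := by fun_prop
  have hcur : Measurable (current (G := G) (k := k)) := measurable_pi_apply _
  have hq : MeasurableSet {q : (Finset.Iic k → State G) × State G | p (current q.1, q.2)} :=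
    ((hcur.comp measurable_fst).prodMk measurable_snd) hp
  have : IsProbabilityMeasure ((G.law S T x).map (Preorder.frestrictLe k)) :=
    Measure.isProbabilityMeasure_map hr.aemeasurable
  have hfib : MeasurableSet {y : Finset.Iic k → State G |
      ∀ᵐ s ∂(G.stepKernel S T k y), p (current y, s)} := by
    simp only [ae_iff]
    exact Kernel.measurable_kernel_prodMk_left (κ := G.stepKernel S T k) hq.compl
      (measurableSet_singleton 0)
  refine ae_of_ae_map hpair.aemeasurable
    (p := fun q : (Finset.Iic k → State G) × State G => p (current q.1, q.2)) ?_
  rw [map_law_succ, Measure.ae_compProd_iff hq, ae_map_iff hr.aemeasurable hfib]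
  exact h

theorem ae_law_reachable (S T : Strategy G) {x : EuclideanSpace ℝ (Fin n)} (hx : x ∈ G.thick) :
    ∀ᵐ ω ∂(G.law S T x), ∀ k, ω k ∈ G.reachable := by
  rw [ae_all_iff]
  intro k
  induction k with
  | zero =>
    filter_upwards [G.ae_law_zero S T x] with ω hω
    simpa [hω, reachable] using hx
  | succ k ih =>
    refine G.ae_law_succ S T x k (p := fun q => q.2 ∈ G.reachable)
      (measurable_snd G.measurableSet_reachable) ?_
    filter_upwards [ih] with ω hω
    exact G.ae_stepLaw_reachable S T _ hω

theorem ae_law_of_ended (S T : Strategy G) (x : EuclideanSpace ℝ (Fin n)) :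
    ∀ᵐ ω ∂(G.law S T x), ∀ k, (ω k).2 = true → ω (k + 1) = ω k := by
  rw [ae_all_iff]
  intro k
  have h1 : MeasurableSet {q : State G × State G | q.1.2 = true} :=
    (measurable_snd.comp measurable_fst) (measurableSet_singleton true)
  have h2 : MeasurableSet {q : State G × State G | q.2 = q.1} :=
    measurableSet_eq_fun measurable_snd measurable_fst
  refine G.ae_law_succ S T x k (p := fun q => q.1.2 = true → q.2 = q.1) (h1.imp h2) ?_
  refine Eventually.of_forall fun ω => ?_
  by_cases hc : (ω k).2 = true
  · have hc' : (current (G := G) (Preorder.frestrictLe k ω)).2 = true := hc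
    rw [stepLaw, if_pos hc', ae_dirac_iff]
    · exact fun _ => rfl
    · simp [hc]
  · simp [hc]

/-! ### The game ends -/

theorem exists_norm_le_of_mem_thick (hn : 2 ≤ n) : ∃ R, ∀ x ∈ G.thick, ‖x‖ ≤ R := by
  have hb : Bornology.IsBounded G.thick :=
    (G.isBounded.union (G.isCompact_strip hn).isBounded).subset
      (union_subset_union_right _ fun _ hx => hx.2)
  exact hb.exists_norm_le

/-- Expand |x + z|² and use 1 + t ≤ exp t; the term linear in z integrates to 0 because the noise is
symmetric. -/
theorem exp_norm_sq_mul_le_integral_noise (l : ℝ) (x : EuclideanSpace ℝ (Fin n))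
    (v : Metric.sphere (0 : EuclideanSpace ℝ (Fin n)) G.ε) :
    Real.exp (l * ‖x‖ ^ 2) * (1 + l * ∫ z, ‖z‖ ^ 2 ∂(noise G.ε (v : EuclideanSpace ℝ (Fin n)))) ≤
      ∫ z, Real.exp (l * ‖x + z‖ ^ 2) ∂(noise G.ε (v : EuclideanSpace ℝ (Fin n))) := by
  have hv := ne_zero_of_mem_sphere G.ε_pos.ne' v
  have := isProbabilityMeasure_noise G.ε_pos hv
  have i : ∀ f : EuclideanSpace ℝ (Fin n) → ℝ, Continuous f →
      Integrable f (noise G.ε (v : EuclideanSpace ℝ (Fin n))) :=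
    fun _ hf => integrable_noise G.ε_pos hv hf
  have h1 : ∫ z, Real.exp (l * ‖x‖ ^ 2) * (1 + (l * ‖z‖ ^ 2 + 2 * l * ⟪x, z⟫))
        ∂(noise G.ε (v : EuclideanSpace ℝ (Fin n))) =
        Real.exp (l * ‖x‖ ^ 2) *
          (1 + l * ∫ z, ‖z‖ ^ 2 ∂(noise G.ε (v : EuclideanSpace ℝ (Fin n)))) := by
    rw [integral_const_mul, integral_add (i _ (by fun_prop)) (i _ (by fun_prop)),
      integral_add (i _ (by fun_prop)) (i _ (by fun_prop)), integral_const_mul,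
      integral_const_mul, integral_inner_noise]
    simp
  rw [← h1]
  refine integral_mono (i _ (by fun_prop)) (i _ (by fun_prop)) fun z => ?_
  have h2 : Real.exp (l * ‖x + z‖ ^ 2) =
      Real.exp (l * ‖x‖ ^ 2) * Real.exp (l * ‖z‖ ^ 2 + 2 * l * ⟪x, z⟫) := by
    rw [← Real.exp_add, norm_add_sq_real]
    congr 1
    ring
  dsimp only
  rw [h2]
  refine mul_le_mul_of_nonneg_left ?_ (Real.exp_pos _).le
  rw [add_comm]
  exact Real.add_one_le_exp _

/-- There is a bounded function, positive on the thickened domain, whose expected value decreases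
by a fixed factor at each move, whatever vector the players choose. -/
theorem exists_contracting_function (hn : 2 ≤ n) :
    ∃ (w : EuclideanSpace ℝ (Fin n) → ℝ) (B q : ℝ), Continuous w ∧ (∀ x, 0 ≤ w x) ∧
      (∀ x, w x ≤ B) ∧ (∀ x ∈ G.thick, 1 ≤ w x) ∧ 0 ≤ q ∧ q < 1 ∧
      ∀ x ∈ G.Ω, ∀ v : Metric.sphere (0 : EuclideanSpace ℝ (Fin n)) G.ε,
        G.average w x v ≤ q * w x := by
  obtain ⟨v₀⟩ := G.nonempty_sphere hn
  obtain ⟨R, hR⟩ := G.exists_norm_le_of_mem_thick hn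
  have hm := integral_norm_sq_noise_pos hn G.ε_pos (ne_zero_of_mem_sphere G.ε_pos.ne' v₀)
  have hmv : ∀ v : Metric.sphere (0 : EuclideanSpace ℝ (Fin n)) G.ε,
      ∫ z, ‖z‖ ^ 2 ∂(noise G.ε (v : EuclideanSpace ℝ (Fin n))) =
        ∫ z, ‖z‖ ^ 2 ∂(noise G.ε (v₀ : EuclideanSpace ℝ (Fin n))) := fun v =>
    integral_norm_sq_noise_eq (by rw [norm_eq_of_mem_sphere, norm_eq_of_mem_sphere])
  generalize ∫ z, ‖z‖ ^ 2 ∂(noise G.ε (v₀ : EuclideanSpace ℝ (Fin n))) = m at hm hmv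
  have hβ := G.β_pos
  -- The intended move will only be estimated by φ ≥ 0, so the noise alone must make φ grow: it
  -- contributes the factor β(1 + lm) = β + 2 > 1.
  obtain ⟨l, hl, hlm⟩ : ∃ l : ℝ, 0 < l ∧ G.β * (1 + l * m) = G.β + 2 :=
    ⟨2 / (G.β * m), by positivity, by field_simp⟩
  let φ : EuclideanSpace ℝ (Fin n) → ℝ := fun x => Real.exp (l * ‖x‖ ^ 2)
  have hφ : Continuous φ := by fun_prop
  have hφ1 : ∀ x, 1 ≤ φ x := fun x => Real.one_le_exp (by positivity)
  obtain ⟨B, hB1, hB⟩ : ∃ B : ℝ, 1 ≤ B ∧ ∀ x ∈ G.thick, φ x + 1 ≤ B := by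
    refine ⟨Real.exp (l * R ^ 2) + 1, by linarith [Real.exp_pos (l * R ^ 2)], fun x hx => ?_⟩
    have h := pow_le_pow_left₀ (norm_nonneg x) (hR x hx) 2
    have := Real.exp_le_exp.2 (mul_le_mul_of_nonneg_left h hl.le)
    exact add_le_add_left this 1
  have hw : ∀ x ∈ G.thick, B - min (φ x) B = B - φ x := fun x hx => by
    rw [min_eq_left]
    linarith [hB x hx]
  -- Truncating φ at B makes w bounded and nonnegative everywhere without changing B - φ on the
  -- thickened domain.
  refine ⟨fun x => B - min (φ x) B, B, 1 - B⁻¹, by fun_prop, fun x => ?_, fun x => ?_,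
    fun x hx => ?_, ?_, ?_, fun x hx v => ?_⟩
  · linarith [min_le_right (φ x) B]
  · have : 0 ≤ min (φ x) B := le_min (by linarith [hφ1 x]) (by linarith)
    linarith
  · dsimp only
    rw [hw x hx]
    linarith [hB x hx]
  · linarith [inv_le_one_of_one_le₀ hB1]
  · linarith [inv_pos.2 (show 0 < B by linarith)]
  · have hv := ne_zero_of_mem_sphere G.ε_pos.ne' v
    have := isProbabilityMeasure_noise G.ε_pos hv
    have h1 : ∫ z, (B - min (φ (x + z)) B) ∂(noise G.ε v) =
        B - ∫ z, φ (x + z) ∂(noise G.ε v) := by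
      have : ∫ z, (B - min (φ (x + z)) B) ∂(noise G.ε v) =
          ∫ z, (B - φ (x + z)) ∂(noise G.ε v) := by
        refine integral_congr_ae ?_
        filter_upwards [ae_mem_orthDisk G.ε (v : EuclideanSpace ℝ (Fin n))] with z hz
        exact hw _ (G.add_mem_thick hx hz.2)
      rw [this, integral_sub (integrable_const _) (G.integrable_comp_add_noise hφ x v)]
      simp
    have h2 : φ x * (1 + l * m) ≤ ∫ z, φ (x + z) ∂(noise G.ε (v : EuclideanSpace ℝ (Fin n))) := by
      rw [← hmv v]
      exact G.exp_norm_sq_mul_le_integral_noise l x v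
    have h3 := mul_le_mul_of_nonneg_left h2 hβ.le
    have h4 : G.β * (φ x * (1 + l * m)) = φ x * (G.β + 2) := by rw [← hlm]; ring
    have h5 : 0 ≤ min (φ (x + v)) B := le_min (by linarith [hφ1 (x + v)]) (by linarith)
    have h6 := mul_nonneg G.α_nonneg h5
    have h7 : 0 ≤ B⁻¹ * φ x := mul_nonneg (by positivity) (by linarith [hφ1 x])
    have h8 : B⁻¹ * B = 1 := inv_mul_cancel₀ (by linarith)
    have h9 := mul_nonneg hβ.le (zero_le_one.trans (hφ1 x))
    have h10 : G.α * B + G.β * B = B := by rw [← add_mul, G.α_add_β, one_mul]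
    have h11 := hφ1 x
    unfold average
    beta_reduce
    rw [h1, hw x (Or.inl hx)]
    -- The average is at most αB + β(B - ∫φ) ≤ B - (β + 2)φ ≤ B - φ - 1 ≤ (1 - 1/B)(B - φ), using φ
    -- ≥ 1.
    linear_combination h3 - h4 + h6 + h7 + h8 + h9 + h10 + h11

/-- Each move from Ω contracts w by q, while ending the game replaces w by 0, which is certain off
Ω. As w can be taken ≥ 1 on the thickened domain, this bounds the probability that the game is still
running at time k. -/
theorem integral_stateFun_le_pow_mul (S T : Strategy G) {x : EuclideanSpace ℝ (Fin n)}
    (hx : x ∈ G.thick) {w : EuclideanSpace ℝ (Fin n) → ℝ} {B q : ℝ} (hw : Continuous w)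
    (hw0 : ∀ x, 0 ≤ w x) (hwB : ∀ x, w x ≤ B) (hq : 0 ≤ q)
    (hwq : ∀ x ∈ G.Ω, ∀ v : Metric.sphere (0 : EuclideanSpace ℝ (Fin n)) G.ε,
        G.average w x v ≤ q * w x) (k : ℕ) :
    ∫ ω, G.stateFun w 0 (ω k) ∂(G.law S T x) ≤ q ^ k * B := by
  have hwK : ∀ y, |w y| ≤ B := fun y => by rw [abs_of_nonneg (hw0 y)]; exact hwB y
  have hB : 0 ≤ B := (hw0 x).trans (hwB x)
  have h0K : ∀ y, |(0 : EuclideanSpace ℝ (Fin n) → ℝ) y| ≤ B := fun y => by simpa using hB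
  have hmeas := G.measurable_stateFun hw.measurable measurable_zero
  have hbd := G.abs_stateFun_le hwK h0K
  have hint : ∀ j, Integrable (fun ω : ℕ → State G => G.stateFun w 0 (ω j)) (G.law S T x) :=
    fun j => integrable_of_abs_le (hmeas.comp (measurable_pi_apply j)) fun ω => hbd (ω j)
  induction k with
  | zero =>
    calc ∫ ω, G.stateFun w 0 (ω 0) ∂(G.law S T x) ≤ ∫ _, B ∂(G.law S T x) :=
          integral_mono (hint 0) (integrable_const _) fun ω => (abs_le.1 (hbd (ω 0))).2
      _ = q ^ 0 * B := by simp
  | succ k ih =>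
    have hstep : ∫ ω, ∫ s, G.stateFun w 0 s ∂(G.stepLaw S T k (Preorder.frestrictLe k ω))
        ∂(G.law S T x) ≤ ∫ ω, q * G.stateFun w 0 (ω k) ∂(G.law S T x) := by
      refine integral_mono_of_nonneg (Eventually.of_forall fun ω => integral_nonneg fun s => ?_)
        ((hint k).const_mul q) ?_
      · unfold stateFun
        split_ifs
        exacts [le_rfl, hw0 _]
      filter_upwards [G.ae_law_reachable S T hx] with ω hω
      by_cases hc : (ω k).2 = true
      · have hc' : (current (G := G) (Preorder.frestrictLe k ω)).2 = true := hc
        rw [G.integral_stepLaw_of_ended S T hc']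
        change G.stateFun w 0 (ω k) ≤ _
        simp [stateFun, hc]
      · have hc' : ¬ (current (G := G) (Preorder.frestrictLe k ω)).2 = true := hc
        rw [G.integral_stepLaw S T hc' hw continuous_zero hwK h0K]
        change G.cutoff (ω k).1 * 0 + (1 - G.cutoff (ω k).1) *
          (2⁻¹ * G.average w (ω k).1 _ + 2⁻¹ * G.average w (ω k).1 _) ≤ _
        have hval : G.stateFun w 0 (ω k) = w (ω k).1 := by simp [stateFun, hc]
        rw [hval]
        have hnn := mul_nonneg hq (hw0 (ω k).1)
        by_cases hΩ : (ω k).1 ∈ G.Ω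
        · have h1 := hwq _ hΩ (S.move k (positions (Preorder.frestrictLe k ω)))
          have h2 := hwq _ hΩ (T.move k (positions (Preorder.frestrictLe k ω)))
          have h3 := G.cutoff_mem (ω k).1
          nlinarith
        · rw [G.cutoff_of_notMem hΩ]
          simpa using hnn
    rw [integral_law_succ _ _ _ _ _ hmeas hbd]
    refine hstep.trans ?_
    rw [integral_const_mul, pow_succ', mul_assoc]
    exact mul_le_mul_of_nonneg_left ih hq

/-! ### The payoff -/

theorem eq_of_ended_of_le {ω : ℕ → State G} (he : ∀ k, (ω k).2 = true → ω (k + 1) = ω k) {j k : ℕ}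
    (hjk : j ≤ k) (hj : (ω j).2 = true) : ω k = ω j := by
  induction k, hjk using Nat.le_induction with
  | base => rfl
  | succ k _ ih => rw [he k (by rw [ih]; exact hj), ih]

theorem payoff_eq_of_ended {ω : ℕ → State G} (hr : ∀ k, ω k ∈ G.reachable)
    (he : ∀ k, (ω k).2 = true → ω (k + 1) = ω k) {C : EuclideanSpace ℝ (Fin n) → ℝ}
    (hC : ∀ x ∈ G.strip, C x = G.F x) {k : ℕ} (hk : (ω k).2 = true) :
    G.payoff ω = C (ω k).1 := by
  classical
  have h : ∃ k, (ω k).2 = true := ⟨k, hk⟩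
  have hfind := G.eq_of_ended_of_le he (Nat.find_le hk) (Nat.find_spec h)
  rw [payoff, dif_pos h, hfind]
  rw [hC _ ((hr _).1 (Nat.find_spec h))]

theorem payoff_eq_zero {ω : ℕ → State G} (h : ¬ ∃ k, (ω k).2 = true) : G.payoff ω = 0 := by
  rw [payoff, dif_neg h]

theorem abs_payoff_le {ω : ℕ → State G} (hr : ∀ k, ω k ∈ G.reachable)
    (he : ∀ k, (ω k).2 = true → ω (k + 1) = ω k) {C : EuclideanSpace ℝ (Fin n) → ℝ}
    (hC : ∀ x ∈ G.strip, C x = G.F x) {K : ℝ} (hK : ∀ x, |C x| ≤ K) : |G.payoff ω| ≤ K := by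
  by_cases h : ∃ k, (ω k).2 = true
  · obtain ⟨k, hk⟩ := h
    rw [G.payoff_eq_of_ended hr he hC hk]
    exact hK _
  · rw [G.payoff_eq_zero h, abs_zero]
    exact (abs_nonneg _).trans (hK 0)

/-- F is arbitrary off the strip, so only almost everywhere measurability is available: the payoff
is almost surely the limit of eventually constant functions of the state, including the default 0
for endless games. -/
theorem aestronglyMeasurable_payoff (S T : Strategy G) {x : EuclideanSpace ℝ (Fin n)}
    (hx : x ∈ G.thick) {C : EuclideanSpace ℝ (Fin n) → ℝ} (hCc : Continuous C)
    (hC : ∀ x ∈ G.strip, C x = G.F x) :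
    AEStronglyMeasurable G.payoff (G.law S T x) := by
  refine aestronglyMeasurable_of_tendsto_ae atTop
    (f := fun k (ω : ℕ → State G) => G.stateFun 0 C (ω k)) (fun k => ?_) ?_
  · exact ((G.measurable_stateFun measurable_zero hCc.measurable).comp
      (measurable_pi_apply k)).aestronglyMeasurable
  · filter_upwards [G.ae_law_reachable S T hx, G.ae_law_of_ended S T x] with ω hr he
    by_cases h : ∃ k, (ω k).2 = true
    · obtain ⟨k, hk⟩ := h
      refine tendsto_const_nhds.congr' ?_
      filter_upwards [eventually_ge_atTop k] with j hj
      have := G.eq_of_ended_of_le he hj hk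
      rw [G.payoff_eq_of_ended hr he hC hk, this]
      simp [stateFun, hk]
    · rw [G.payoff_eq_zero h]
      simp only [not_exists] at h
      simp [stateFun, h]

theorem abs_integral_payoff_le (S T : Strategy G) {x : EuclideanSpace ℝ (Fin n)}
    (hx : x ∈ G.thick) {C : EuclideanSpace ℝ (Fin n) → ℝ}
    (hC : ∀ x ∈ G.strip, C x = G.F x) {K : ℝ} (hK : ∀ x, |C x| ≤ K) :
    |∫ ω, G.payoff ω ∂(G.law S T x)| ≤ K := by
  have h := norm_integral_le_of_norm_le_const (μ := G.law S T x) (f := G.payoff) (C := K) (by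
    filter_upwards [G.ae_law_reachable S T hx, G.ae_law_of_ended S T x] with ω hr he
    exact G.abs_payoff_le hr he hC hK)
  simpa using h

/-- The expected payoff is at least the expected value of a bounded function of the state at a
given time that agrees with the boundary data once the game has ended, up to an error that is
controlled by the event that the game has not ended. -/
theorem integral_stateFun_sub_le_integral_payoff (S T : Strategy G)
    {x : EuclideanSpace ℝ (Fin n)} (hx : x ∈ G.thick) {C a w : EuclideanSpace ℝ (Fin n) → ℝ}
    (hCc : Continuous C) (hC : ∀ x ∈ G.strip, C x = G.F x) {K B : ℝ} (hK : ∀ x, |C x| ≤ K)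
    (ha : Continuous a) (haK : ∀ x, |a x| ≤ K) (hw : Continuous w) (hwB : ∀ x, |w x| ≤ B)
    (hw1 : ∀ x ∈ G.thick, 1 ≤ w x) (k : ℕ) :
    ∫ ω, G.stateFun a C (ω k) ∂(G.law S T x) -
        2 * K * ∫ ω, G.stateFun w 0 (ω k) ∂(G.law S T x) ≤
      ∫ ω, G.payoff ω ∂(G.law S T x) := by
  have hK0 : 0 ≤ K := (abs_nonneg _).trans (hK 0)
  have h0 : ∀ y, |(0 : EuclideanSpace ℝ (Fin n) → ℝ) y| ≤ B := fun y => by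
    simpa using (abs_nonneg _).trans (hwB 0)
  have i1 : Integrable (fun ω : ℕ → State G => G.stateFun a C (ω k)) (G.law S T x) :=
    integrable_of_abs_le ((G.measurable_stateFun ha.measurable hCc.measurable).comp
      (measurable_pi_apply k)) fun ω => G.abs_stateFun_le haK hK (ω k)
  have i2 : Integrable (fun ω : ℕ → State G => G.stateFun w 0 (ω k)) (G.law S T x) :=
    integrable_of_abs_le ((G.measurable_stateFun hw.measurable measurable_zero).comp
      (measurable_pi_apply k)) fun ω => G.abs_stateFun_le hwB h0 (ω k)
  have hae : ∀ᵐ ω ∂(G.law S T x), (∀ k, ω k ∈ G.reachable) ∧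
      ∀ k, (ω k).2 = true → ω (k + 1) = ω k :=
    (G.ae_law_reachable S T hx).and (G.ae_law_of_ended S T x)
  have i3 : Integrable G.payoff (G.law S T x) := by
    refine Integrable.of_bound (G.aestronglyMeasurable_payoff S T hx hCc hC) K ?_
    filter_upwards [hae] with ω hω
    exact G.abs_payoff_le hω.1 hω.2 hC hK
  rw [← integral_const_mul, ← integral_sub i1 (i2.const_mul _)]
  refine integral_mono_ae (i1.sub (i2.const_mul _)) i3 ?_
  filter_upwards [hae] with ω ⟨hr, he⟩
  -- After the end the two payoffs agree and w is replaced by 0; before it they differ by at most 2K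
  -- ≤ 2K w.
  by_cases hk : (ω k).2 = true
  · rw [G.payoff_eq_of_ended hr he hC hk]
    simp [stateFun, hk]
  · have h1 := (abs_le.1 (G.abs_payoff_le hr he hC hK)).1
    have h2 := (abs_le.1 (haK (ω k).1)).2
    have h3 := mul_le_mul_of_nonneg_left (hw1 _ ((hr k).2 (by simpa using hk))) hK0
    simp only [stateFun, hk]
    simp only [Bool.false_eq_true, if_false]
    linarith

/-! ### Nearly optimal strategies with a finite horizon -/

/-- The strategy that uses a function of the time and of the current position. -/
def markovStrategy (s : ℕ → EuclideanSpace ℝ (Fin n) →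
    Metric.sphere (0 : EuclideanSpace ℝ (Fin n)) G.ε) (hs : ∀ k, Measurable (s k)) :
    Strategy G where
  move k h := s k (h ⟨k, Finset.mem_Iic.2 le_rfl⟩)
  measurable_move k := (hs k).comp (measurable_pi_apply _)

/-- Player I comes within η of the supremum and Player II can do no better than the infimum; the
loss is weighted by (1 - δ)/2 ≤ 1. -/
theorem stateFun_opWith_sub_le_integral_stepLaw (S T : Strategy G) {k : ℕ}
    (h : Finset.Iic k → State G) {C u : EuclideanSpace ℝ (Fin n) → ℝ} (hCc : Continuous C)
    (hu : Continuous u) {K : ℝ} (hK : ∀ x, |C x| ≤ K) (huK : ∀ x, |u x| ≤ K) {η : ℝ} (hη : 0 ≤ η)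
    (hS : (⨆ v : Metric.sphere (0 : EuclideanSpace ℝ (Fin n)) G.ε,
      G.average u (current h).1 v) - η ≤ G.average u (current h).1 (S.move k (positions h))) :
    G.stateFun (G.opWith C u) C (current h) - η ≤
      ∫ s, G.stateFun u C s ∂(G.stepLaw S T k h) := by
  by_cases hc : (current h).2 = true
  · rw [G.integral_stepLaw_of_ended S T hc]
    simp [stateFun, hc, hη]
  · rw [G.integral_stepLaw S T hc hu hCc huK hK]
    have hT := ciInf_le (G.bddBelow_average hu huK (current h).1) (T.move k (positions h))
    have hδ := G.cutoff_mem (current h).1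
    have hval : G.stateFun (G.opWith C u) C (current h) = G.opWith C u (current h).1 := by
      simp [stateFun, hc]
    rw [hval, opWith]
    have h1 := mul_le_mul_of_nonneg_left (add_le_add hS hT)
      (show 0 ≤ (1 - G.cutoff (current h).1) / 2 by linarith)
    have h2 := mul_nonneg hδ.1 hη
    linear_combination h1 + h2 / 2 + hη / 2

/-- Backward induction: V_{N-j} at time j, replaced by C once the game has ended, is a submartingale
up to a loss of η per step. The strategy depends on N and η, but not on the opponent or the starting
point. -/
theorem exists_strategy_sub_le_integral_stateFun (hn : 2 ≤ n)
    {C : EuclideanSpace ℝ (Fin n) → ℝ} (hCc : Continuous C) {K M : ℝ} (hK : ∀ x, |C x| ≤ K)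
    (hM : |M| ≤ K) {η : ℝ} (hη : 0 < η) (N : ℕ) :
    ∃ S : Strategy G, ∀ (T : Strategy G) (x : EuclideanSpace ℝ (Fin n)),
      G.iterateWith C M N x - N * η ≤
        ∫ ω, G.stateFun (fun _ => M) C (ω N) ∂(G.law S T x) := by
  have := G.nonempty_sphere hn
  have hV := G.continuous_iterateWith_and_abs_le hn hCc hK hM
  choose s hs hsup using fun m => exists_measurable_iSup_sub_le
    (g := fun x (v : Metric.sphere (0 : EuclideanSpace ℝ (Fin n)) G.ε) =>
      G.average (G.iterateWith C M m) x v) (G.continuous_average (hV m).1 (hV m).2) hη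
  -- The move at time j leads from V_{N-j} to V_{N-j-1}, hence the index; moves at times j ≥ N,
  -- where the subtraction truncates, play no role.
  refine ⟨G.markovStrategy (fun j => s (N - 1 - j)) fun j => hs _, fun T x => ?_⟩
  set S := G.markovStrategy (fun j => s (N - 1 - j)) fun j => hs _ with hSdef
  have hmeas : ∀ m, Measurable (G.stateFun (G.iterateWith C M m) C) := fun m =>
    G.measurable_stateFun (hV m).1.measurable hCc.measurable
  have hbd : ∀ m s, |G.stateFun (G.iterateWith C M m) C s| ≤ K := fun m =>
    G.abs_stateFun_le (hV m).2 hK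
  have key : ∀ j m, j + m = N → G.iterateWith C M N x - j * η ≤
      ∫ ω, G.stateFun (G.iterateWith C M m) C (ω j) ∂(G.law S T x) := by
    intro j
    induction j with
    | zero =>
      intro m hm
      have h0 : ∫ ω, G.stateFun (G.iterateWith C M m) C (ω 0) ∂(G.law S T x) =
          ∫ _, G.iterateWith C M m x ∂(G.law S T x) := by
        refine integral_congr_ae ?_
        filter_upwards [G.ae_law_zero S T x] with ω hω
        simp [hω, stateFun]
      rw [h0, ← hm]
      simp
    | succ j ih =>
      intro m hm
      have ih' := ih (m + 1) (by omega)
      have i1 : Integrable (fun ω : ℕ → State G =>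
          G.stateFun (G.iterateWith C M (m + 1)) C (ω j)) (G.law S T x) :=
        integrable_of_abs_le ((hmeas _).comp (measurable_pi_apply j)) fun ω => hbd _ (ω j)
      have i2 : Integrable (fun ω : ℕ → State G => ∫ s, G.stateFun (G.iterateWith C M m) C s
          ∂(G.stepLaw S T j (Preorder.frestrictLe j ω))) (G.law S T x) := by
        refine integrable_of_abs_le (K := K) ?_ fun ω => ?_
        · exact ((hmeas m).stronglyMeasurable.integral_kernel
            (κ := G.stepKernel S T j)).measurable.comp (by fun_prop)
        · have := G.isProbabilityMeasure_stepLaw S T j (Preorder.frestrictLe j ω)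
          simpa using norm_integral_le_of_norm_le_const
            (μ := G.stepLaw S T j (Preorder.frestrictLe j ω))
            (f := G.stateFun (G.iterateWith C M m) C) (Eventually.of_forall (hbd m))
      rw [integral_law_succ _ _ _ _ _ (hmeas m) (hbd m)]
      have hstep := integral_mono (i1.sub (integrable_const η)) i2 fun ω => by
        have hN : N - 1 - j = m := by omega
        refine (le_of_eq ?_).trans (G.stateFun_opWith_sub_le_integral_stepLaw S T
          (Preorder.frestrictLe j ω) (u := G.iterateWith C M m) hCc (hV m).1 hK (hV m).2 hη.le ?_)
        · rw [← iterateWith_succ]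
          rfl
        · have := hsup m (ω j).1
          rw [← hN] at this ⊢
          exact this
      simp only [Pi.sub_apply] at hstep
      rw [integral_sub i1 (integrable_const η)] at hstep
      simp only [integral_const, probReal_univ, one_smul] at hstep
      push_cast
      linarith
  have := key N 0 (by simp)
  rwa [iterateWith_zero] at this

theorem iterateWith_sub_le_valueI (hn : 2 ≤ n) {C : EuclideanSpace ℝ (Fin n) → ℝ}
    (hCc : Continuous C) (hC : ∀ x ∈ G.strip, C x = G.F x) {K M : ℝ} (hK : ∀ x, |C x| ≤ K)
    (hM : |M| ≤ K) :
    ∃ B q : ℝ, 0 ≤ q ∧ q < 1 ∧ ∀ (N : ℕ) (η : ℝ), 0 < η → ∀ x ∈ G.thick,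
      G.iterateWith C M N x - N * η - 2 * K * (q ^ N * B) ≤ G.valueI x := by
  obtain ⟨w, B, q, hw, hw0, hwB, hw1, hq0, hq1, hwq⟩ := G.exists_contracting_function hn
  refine ⟨B, q, hq0, hq1, fun N η hη x hx => ?_⟩
  obtain ⟨S, hS⟩ := G.exists_strategy_sub_le_integral_stateFun hn hCc hK hM hη N
  have hK0 : 0 ≤ K := (abs_nonneg _).trans (hK 0)
  have : Nonempty (Strategy G) := ⟨S⟩
  have hb := fun S T : Strategy G => abs_le.1 (G.abs_integral_payoff_le S T hx hC hK)
  -- Real suprema and infima take default values on unbounded families; the uniform bound K on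
  -- expected payoffs makes those in the value genuine.
  have hbelow : ∀ S : Strategy G,
      BddBelow (range fun T : Strategy G => ∫ ω, G.payoff ω ∂(G.law S T x)) := fun S =>
    ⟨-K, by rintro _ ⟨T, rfl⟩; exact (hb S T).1⟩
  have habove : BddAbove (range fun S : Strategy G =>
      ⨅ T : Strategy G, ∫ ω, G.payoff ω ∂(G.law S T x)) :=
    ⟨K, by rintro _ ⟨S', rfl⟩; exact (ciInf_le (hbelow S') S).trans (hb S' S).2⟩
  refine le_trans (le_ciInf fun T => ?_) (le_ciSup habove S)
  have h1 := G.integral_stateFun_sub_le_integral_payoff S T hx hCc hC hK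
    (a := fun _ => M) continuous_const (fun _ => hM) hw
    (fun y => by rw [abs_of_nonneg (hw0 y)]; exact hwB y) hw1 N
  have h2 := mul_le_mul_of_nonneg_left
    (G.integral_stateFun_le_pow_mul S T hx hw hw0 hwB hq0 hwq N) (show 0 ≤ 2 * K by linarith)
  linarith [hS T x]

end Data

end TugOfWar

/-! ### Letting the horizon tend to infinity -/

theorem mainTheorem6 {n : ℕ} (hn : 2 ≤ n) (G : TugOfWar.Data n) :
    ∀ x ∈ G.thick,
      Tendsto (fun k => G.upperIterate k x) atTop (𝓝 (G.upperSolution x)) ∧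
        G.upperSolution x ≤ G.valueI x := by
  intro x hx
  obtain ⟨C, hCc, hC, hCM, K, hK, hM⟩ := G.exists_extension hn
  have heq : (fun k => G.upperIterate k x) =
      fun k => G.iterateWith C (sSup (G.F '' G.strip)) k x :=
    funext fun k => G.upperIterate_eq_iterateWith hC k x hx
  have hanti := G.antitone_iterateWith hn hCc hK hM hCM x
  have hV := G.continuous_iterateWith_and_abs_le hn hCc hK hM
  have hbdd : BddBelow (range fun k => G.iterateWith C (sSup (G.F '' G.strip)) k x) :=
    ⟨-K, by rintro _ ⟨k, rfl⟩; exact (abs_le.1 ((hV k).2 x)).1⟩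
  have hlim : Tendsto (fun k => G.upperIterate k x) atTop (𝓝 (G.upperSolution x)) := by
    refine tendsto_nhds_limUnder ⟨⨅ k, G.iterateWith C (sSup (G.F '' G.strip)) k x, ?_⟩
    rw [heq]
    exact tendsto_atTop_ciInf hanti hbdd
  refine ⟨hlim, ?_⟩
  obtain ⟨B, q, hq0, hq1, hval⟩ := G.iterateWith_sub_le_valueI hn hCc hC hK hM
  -- A decreasing limit lies below each iterate, so no rate of convergence of V_N to ū is needed.
  have hle : ∀ N, G.upperSolution x ≤ G.iterateWith C (sSup (G.F '' G.strip)) N x :=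
    fun N => hanti.le_of_tendsto (heq ▸ hlim) N
  have hbound : ∀ N, G.upperSolution x - 2 * K * (q ^ N * B) ≤ G.valueI x := fun N => by
    refine le_of_forall_pos_le_add fun r hr => ?_
    -- With this η the loss accumulated over N steps is at most r, also for N = 0.
    have h1 := hval N (r / (N + 1)) (by positivity) x hx
    have h2 : N * (r / (N + 1)) ≤ r := by
      rw [mul_div_assoc', div_le_iff₀ (by positivity)]
      linarith
    linarith [hle N]
  have ht : Tendsto (fun N : ℕ => G.upperSolution x - 2 * K * (q ^ N * B)) atTop
      (𝓝 (G.upperSolution x - 2 * K * (0 * B))) :=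
    tendsto_const_nhds.sub
      (tendsto_const_nhds.mul ((tendsto_pow_atTop_nhds_zero_of_lt_one hq0 hq1).mul_const B))
  have := le_of_tendsto' ht hbound
  simpa using this
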